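/- Let $k$ be a field of characteristic zero. Let $\mathcal H_{CK}$ be the Connes–Kreimer Hopf algebra: the free commutative $k$-algebra on the non-empty (non-planar) rooted trees, with basis the rooted forests, graded by the number of vertices, with coproduct given on a tree by $$\Delta_{CK}(t)=t\otimes 1+\sum_{c}P^c(t)\otimes R^c(t),$$ where $c$ runs over the admissible cuts of $t$ (sets of edges, possibly empty, meeting every path from the root to a leaf at most once), $P^c(t)$ is the forest above the cut and $R^c(t)$ the tree under it. Let $\mathcal H$ be the free commutative $k$-algebra on the rooted trees with at least one edge, graded by the number of edges, whose unit is identified with the one-vertex tree $\bullet$, and whose counit $\epsilon$ vanishes on all trees with at least one edge. Let $\Phi:\mathcal H_{CK}\to\mathcal H\otimes\mathcal H_{CK}$ be the algebra morphism given on every non-empty tree $t$ by $$\Phi(t)=\sum_{s\subseteq t}s\otimes t/s,$$ where $s$ runs over the subforests of $t$ (families of pairwise disjoint subtrees with at least one edge each, including the empty family, which stands for the unit $\bullet$ of $\mathcal H$), and $t/s$ is obtained from $t$ by contracting each component of $s$ to a vertex. A character of $\mathcal H$ is a unital algebra morphism $\varphi:\mathcal H\to k$; an infinitesimal character is a linear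 map $a:\mathcal H\to k$ with $a(xy)=a(x)\epsilon(y)+\epsilon(x)a(y)$. For a linear map $a:\mathcal H\to k$ put ${}^tL_a=(a\otimes\mathrm{Id})\circ\Phi:\mathcal H_{CK}\to\mathcal H_{CK}$, and $L_a(b)=(a\otimes b)\circ\Phi$ for $b$ in the linear dual $\mathcal H_{CK}^*$. Let $\mathcal H_{CK}^\circ\subset\mathcal H_{CK}^*$ and $\mathcal H^\circ\subset\mathcal H^*$ be the graded duals (linear forms that vanish in all large degrees). Regard $\mathcal H_{CK}^*$, the completion of $\mathcal H_{CK}^\circ$, as a complete Hopf algebra: its product is the convolution product, its unit the counit of $\mathcal H_{CK}$, its counit the evaluation at $1$, and its coproduct, with values in the completed tensor square $(\mathcal H_{CK}\otimes\mathcal H_{CK})^*$, and antipode are the transposes of the product and the antipode of $\mathcal H_{CK}$. 1. For every infinitesimal character $a$ of $\mathcal H$, the operator ${}^tL_a$ is a biderivation of $\mathcal H_{CK}$, i.e. ${}^tL_a(xy)={}^tL_a(x)\,y+x\,{}^tL_a(y)$ and $\Delta_{CK}\circ{}^tL_a=({}^tL_a\otimes\mathrm{Id}+\mathrm{Id}\otimes{}^tL_a)\circ\Delta_{CK}$.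 2. For every character $\varphi$ of $\mathcal H$, the operator ${}^tL_\varphi$ is an automorphism of the Hopf algebra $\mathcal H_{CK}$. 3. For every infinitesimal character $a$ of $\mathcal H$, the operator $L_a$ is the transpose of ${}^tL_a$ and is a biderivation of the complete Hopf algebra $\mathcal H_{CK}^*$. If moreover $a\in\mathcal H^\circ$, then $L_a$ maps $\mathcal H_{CK}^\circ$ to itself and is a biderivation of the Hopf algebra $\mathcal H_{CK}^\circ$. 4. For every character $\varphi$ of $\mathcal H$, the operator $L_\varphi$ is the transpose of ${}^tL_\varphi$ and is an automorphism of the complete Hopf algebra $\mathcal H_{CK}^*$. -/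

import Mathlib

open scoped TensorProduct

namespace ForestHopf

/-! ### Rooted trees and forests -/

/-- Planar rooted forests: `cons c r` is the forest whose first tree has a root with the forest `c`
of branches above it, i.e. the tree `B₊(c)`, followed by the forest `r` of the other trees.
A planar rooted tree `B₊(c)` is encoded by the forest `c` of the branches of its root. -/
inductive PForest : Type
  | nil : PForest
  | cons (branches rest : PForest) : PForest

namespace PForest

/-- Juxtaposition of forests. -/
def append : PForest → PForest → PForest
  | nil, g => g
  | cons c r, g => cons c (append r g)

/-- Number of vertices of a forest. It is the number of edges of the tree `B₊(f)`. -/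
def size : PForest → ℕ
  | nil => 0
  | cons c r => c.size + 1 + r.size

/-- Elementary changes of the planar order: exchange two neighbouring trees of the forest, or two
neighbouring branches at any vertex. Two planar forests have the same underlying (non-planar)
rooted forest if and only if a chain of such moves connects them. -/
inductive Move : PForest → PForest → Prop
  | swap (c d r : PForest) : Move (cons c (cons d r)) (cons d (cons c r))
  | branches {c c' : PForest} (r : PForest) : Move c c' → Move (cons c r) (cons c' r)
  | rest (c : PForest) {r r' : PForest} : Move r r' → Move (cons c r) (cons c r')

end PForest

/-- Non-empty (non-planar) rooted trees: `RTree.mk c` is the tree `B₊(c)`. -/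
def RTree : Type := Quot PForest.Move

/-- The tree `B₊(c)`. -/
def RTree.mk (c : PForest) : RTree := Quot.mk _ c

/-- The tree with one vertex. -/
def RTree.bullet : RTree := RTree.mk PForest.nil

lemma PForest.Move.size_eq {c d : PForest} (h : PForest.Move c d) : c.size = d.size := by
  induction h with
  | swap => simp only [PForest.size]; omega
  | branches _ _ ih => simp only [PForest.size, ih]
  | rest _ _ ih => simp only [PForest.size, ih]

/-- Number of edges of a rooted tree. -/
def RTree.edges : RTree → ℕ := Quot.lift PForest.size fun _ _ h => h.size_eq

/-- Number of vertices of a rooted tree. -/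
def RTree.vertices (t : RTree) : ℕ := t.edges + 1

/-! ### Sets of edges of a rooted tree -/

/-- A planar rooted tree together with a set of edges, the marked ones. The tree is given by the
forest of branches of its root; the label of a branch tells whether the edge from the root to that
branch is marked. -/
inductive MForest : Type
  | nil : MForest
  | cons (mark : Bool) (branches rest : MForest) : MForest

/-- All sets of edges of the tree `B₊(c)`, each of them listed once. -/
def PForest.markings : PForest → List MForest
  | .nil => [.nil]
  | .cons c r => (([true, false] : List Bool) ×ˢ (c.markings ×ˢ r.markings)).map
      fun p => .cons p.1 p.2.1 p.2.2

namespace MForest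

/-- The underlying tree. -/
def erase : MForest → PForest
  | nil => .nil
  | cons _ c r => .cons c.erase r.erase

/-- Branches of the connected component of the root in the graph formed by the marked edges. -/
def rootComponent : MForest → PForest
  | nil => .nil
  | cons true c r => .cons c.rootComponent r.rootComponent
  | cons false _ r => r.rootComponent

/-- The connected components of the graph formed by all the vertices and the marked edges, without
the component of the root. -/
def otherComponents : MForest → PForest
  | nil => .nil
  | cons true c r => c.otherComponents.append r.otherComponents
  | cons false c r => .cons c.rootComponent (c.otherComponents.append r.otherComponents)

/-- All connected components of the graph formed by all the vertices and the marked edges. -/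
def components (m : MForest) : PForest := .cons m.rootComponent m.otherComponents

/-- Branches of the tree obtained by contracting every marked edge. -/
def contract : MForest → PForest
  | nil => .nil
  | cons true c r => c.contract.append r.contract
  | cons false c r => .cons c.contract r.contract

/-- No edge is marked. -/
def unmarked : MForest → Bool
  | nil => true
  | cons b c r => !b && c.unmarked && r.unmarked

/-- Admissible cuts: every path from the root to a leaf contains at most one marked edge. -/
def admissible : MForest → Bool
  | nil => true
  | cons true c r => c.unmarked && r.admissible
  | cons false c r => c.admissible && r.admissible

/-- The pruning of an admissible cut: the trees above the marked edges. -/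
def pruning : MForest → PForest
  | nil => .nil
  | cons true c r => .cons c.erase r.pruning
  | cons false c r => c.pruning.append r.pruning

/-- The trunk of an admissible cut, i.e. the tree under the marked edges, given by its branches. -/
def trunk : MForest → PForest
  | nil => .nil
  | cons true _ r => r.trunk
  | cons false c r => .cons c.trunk r.trunk

end MForest

/-- The admissible cuts of the tree `B₊(c)` (the total cut is not among them). -/
def PForest.cuts (c : PForest) : List MForest := c.markings.filter MForest.admissible

noncomputable section

universe u

variable (k : Type u) [CommRing k]

/-! ### The two algebras -/

/-- The Connes–Kreimer algebra: the free commutative algebra on the non-empty rooted trees. Its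
basis of monomials is formed by the rooted forests. -/
def HCK : Type u := MvPolynomial RTree k

instance : CommRing (HCK k) := inferInstanceAs (CommRing (MvPolynomial RTree k))
instance : Algebra k (HCK k) := inferInstanceAs (Algebra k (MvPolynomial RTree k))

/-- The algebra `𝓗 = S(T')`: the free commutative algebra on the rooted trees with at least one
edge. -/
def HCon : Type u := MvPolynomial {t : RTree // t ≠ RTree.bullet} k

instance : CommRing (HCon k) :=
  inferInstanceAs (CommRing (MvPolynomial {t : RTree // t ≠ RTree.bullet} k))
instance : Algebra k (HCon k) :=
  inferInstanceAs (Algebra k (MvPolynomial {t : RTree // t ≠ RTree.bullet} k))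

namespace HCK

variable {k}

/-- A tree as a generator of the Connes–Kreimer algebra. -/
def tree (t : RTree) : HCK k := MvPolynomial.X (R := k) t

/-- A forest as an element of the Connes–Kreimer algebra. -/
def forest : PForest → HCK k
  | .nil => 1
  | .cons c r => tree (RTree.mk c) * forest r

/-- The algebra morphism with given values on trees. -/
def lift {A : Type*} [CommRing A] [Algebra k A] (g : RTree → A) : HCK k →ₐ[k] A :=
  MvPolynomial.aeval (R := k) g

@[simp] lemma lift_tree {A : Type*} [CommRing A] [Algebra k A] (g : RTree → A) (t : RTree) :
    lift (k := k) g (tree t) = g t := MvPolynomial.aeval_X _ _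

lemma algHom_ext {A : Type*} [Semiring A] [Algebra k A] {g h : HCK k →ₐ[k] A}
    (H : ∀ t, g (tree t) = h (tree t)) : g = h :=
  MvPolynomial.algHom_ext (R := k) H

lemma forest_append (c d : PForest) :
    (forest (c.append d) : HCK k) = forest c * forest d := by
  induction c with
  | nil => simp [forest, PForest.append]
  | cons c r _ ih => simp [forest, PForest.append, ih, mul_assoc]

end HCK

namespace HCon

variable {k}

open Classical in
/-- A tree as an element of `𝓗`; the one-vertex tree is the unit of `𝓗`. -/
def tree (t : RTree) : HCon k :=
  if h : t = RTree.bullet then 1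
  else MvPolynomial.X (R := k) (⟨t, h⟩ : {t : RTree // t ≠ RTree.bullet})

/-- A forest as an element of `𝓗`, the one-vertex components being discarded. -/
def forest : PForest → HCon k
  | .nil => 1
  | .cons c r => tree (RTree.mk c) * forest r

/-- The counit of `𝓗`: it vanishes on the trees with at least one edge. -/
def counit : HCon k →ₐ[k] k :=
  MvPolynomial.aeval (R := k) fun _ : {t : RTree // t ≠ RTree.bullet} => (0 : k)

lemma forest_append (c d : PForest) :
    (forest (c.append d) : HCon k) = forest c * forest d := by
  induction c with
  | nil => simp [forest, PForest.append]
  | cons c r _ ih => simp [forest, PForest.append, ih, mul_assoc]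

end HCon

/-! ### The operator `B₊` -/

namespace PForest

/-- The planar forest with a given list of trees. -/
def ofList : List PForest → PForest
  | [] => nil
  | c :: l => cons c (ofList l)

/-- The list of trees of a planar forest. -/
def toList : PForest → List PForest
  | nil => []
  | cons c r => c :: r.toList

lemma ofList_toList (f : PForest) : ofList f.toList = f := by
  induction f with
  | nil => rfl
  | cons c r _ ih => simp [toList, ofList, ih]

end PForest

lemma RTree.mk_eq {c d : PForest} (h : PForest.Move c d) : RTree.mk c = RTree.mk d := Quot.sound h

lemma RTree.mk_cons_rest (c : PForest) {r r' : PForest} (h : RTree.mk r = RTree.mk r') :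
    RTree.mk (.cons c r) = RTree.mk (.cons c r') :=
  congrArg (Quot.map (PForest.cons c) fun _ _ => PForest.Move.rest c) h

lemma RTree.mk_cons_branches {c c' : PForest} (r : PForest) (h : RTree.mk c = RTree.mk c') :
    RTree.mk (.cons c r) = RTree.mk (.cons c' r) :=
  congrArg (Quot.map (fun c => PForest.cons c r) fun _ _ => PForest.Move.branches r) h

lemma RTree.mk_ofList_perm {l l' : List PForest} (h : l.Perm l') :
    RTree.mk (.ofList l) = RTree.mk (.ofList l') := by
  induction h with
  | nil => rfl
  | cons c _ ih => exact RTree.mk_cons_rest c ih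
  | swap c d l => exact RTree.mk_eq (.swap _ _ _)
  | trans _ _ ih ih' => exact ih.trans ih'

/-- The tree with given branches at its root. -/
def RTree.graft (s : Multiset RTree) : RTree :=
  Quotient.liftOn s (fun l => RTree.mk (.ofList (l.map Quot.out)))
    fun _ _ h => RTree.mk_ofList_perm (h.map _)

lemma RTree.mk_out (t : RTree) : RTree.mk (Quot.out t) = t := Quot.out_eq t

lemma RTree.graft_coe (c : PForest) :
    RTree.graft (c.toList.map RTree.mk : List RTree) = RTree.mk c := by
  change RTree.mk (.ofList ((c.toList.map RTree.mk).map Quot.out)) = _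
  induction c with
  | nil => rfl
  | cons c r _ ih =>
    exact (RTree.mk_cons_rest _ ih).trans (RTree.mk_cons_branches _ (RTree.mk_out _))

/-- The operator `B₊`, which grafts the trees of a forest on a common new root. -/
def bPlus : HCK k →ₗ[k] HCK k :=
  (MvPolynomial.basisMonomials RTree k).constr k
    fun s => HCK.tree (RTree.graft (Finsupp.toMultiset s))

variable {k}

open Classical in
lemma HCK.forest_eq (c : PForest) : (HCK.forest c : HCK k) =
    MvPolynomial.monomial (Multiset.toFinsupp (c.toList.map RTree.mk : List RTree)) (1 : k) := by
  induction c with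
  | nil => rfl
  | cons c r _ ih =>
    rw [HCK.forest, ih, HCK.tree, MvPolynomial.X]
    refine (MvPolynomial.monomial_mul (R := k)).trans ?_
    rw [PForest.toList, List.map_cons, ← Multiset.cons_coe, ← Multiset.singleton_add, map_add,
      Multiset.toFinsupp_singleton, one_mul]

lemma bPlus_forest (c : PForest) : bPlus k (HCK.forest c) = HCK.tree (RTree.mk c) := by
  classical
  rw [HCK.forest_eq, bPlus]
  have := (MvPolynomial.basisMonomials RTree k).constr_basis k
    (fun s => (HCK.tree (RTree.graft (Finsupp.toMultiset s)) : HCK k))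
    (Multiset.toFinsupp (c.toList.map RTree.mk : List RTree))
  rw [MvPolynomial.coe_basisMonomials] at this
  refine this.trans ?_
  rw [Multiset.toFinsupp_toMultiset, RTree.graft_coe]

lemma HCK.exists_forest (s : RTree →₀ ℕ) :
    ∃ c : PForest, (HCK.forest c : HCK k) = MvPolynomial.monomial s (1 : k) := by
  classical
  refine ⟨.ofList ((Finsupp.toMultiset s).toList.map Quot.out), ?_⟩
  have h : ∀ l : List RTree, (PForest.ofList (l.map Quot.out)).toList.map RTree.mk = l := by
    intro l
    induction l with
    | nil => rfl
    | cons a l ih => exact congrArg₂ List.cons (RTree.mk_out a) ih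
  rw [HCK.forest_eq, h, Multiset.coe_toList, Finsupp.toMultiset_toFinsupp]

lemma HCK.linearMap_ext {M : Type*} [AddCommMonoid M] [Module k M] {g h : HCK k →ₗ[k] M}
    (H : ∀ c, g (HCK.forest c) = h (HCK.forest c)) : g = h := by
  refine (MvPolynomial.basisMonomials RTree k).ext (M₁ := M) fun s => ?_
  obtain ⟨c, hc⟩ := HCK.exists_forest (k := k) s
  rw [MvPolynomial.coe_basisMonomials]
  have := H c
  rw [hc] at this
  exact this

/-! ### The Connes–Kreimer coproduct -/

lemma sum_filter_map {α M : Type*} [AddCommMonoid M] (p : α → Bool) (F : α → M) (l : List α) :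
    ((l.filter p).map F).sum = (l.map fun x => if p x then F x else 0).sum := by
  induction l with
  | nil => rfl
  | cons a l ih => by_cases h : p a <;> simp [h, ih]

lemma sum_markings_cons {M : Type*} [AddCommMonoid M] (c r : PForest) (F : MForest → M) :
    ((PForest.cons c r).markings.map F).sum =
      (c.markings.map fun m => (r.markings.map fun n => F (.cons true m n)).sum).sum +
      (c.markings.map fun m => (r.markings.map fun n => F (.cons false m n)).sum).sum := by
  have key : ∀ (b : Bool) (l l' : List MForest),
      (((l ×ˢ l').map (Prod.mk b)).map fun p => F (.cons p.1 p.2.1 p.2.2)).sum =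
        (l.map fun m => (l'.map fun n => F (.cons b m n)).sum).sum := by
    intro b l l'
    induction l with
    | nil => rfl
    | cons a l ih => simpa [Function.comp_def] using congrArg (_ + ·) ih
  have h : ((([true, false] : List Bool) ×ˢ (c.markings ×ˢ r.markings)) :
      List (Bool × MForest × MForest)) =
      (c.markings ×ˢ r.markings).map (Prod.mk true) ++
        (c.markings ×ˢ r.markings).map (Prod.mk false) := by
    simp
  rw [PForest.markings, List.map_map, h, List.map_append, List.sum_append]
  exact congrArg₂ (· + ·) (key _ _ _) (key _ _ _)

lemma erase_of_mem_markings (c : PForest) : ∀ m ∈ c.markings, m.erase = c := by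
  induction c with
  | nil => simp [PForest.markings, MForest.erase]
  | cons c r ihc ihr =>
    intro m hm
    simp only [PForest.markings, List.mem_map] at hm
    obtain ⟨⟨b, m, n⟩, h, rfl⟩ := hm
    obtain ⟨-, h⟩ := List.pair_mem_product.1 h
    obtain ⟨h1, h2⟩ := List.pair_mem_product.1 h
    rw [MForest.erase, ihc _ h1, ihr _ h2]

lemma sum_mul_sum {A : Type*} [CommRing A] (l l' : List MForest) (F G : MForest → A) :
    (l.map fun m => (l'.map fun n => F m * G n).sum).sum = (l.map F).sum * (l'.map G).sum := by
  simp [List.sum_map_mul_left, List.sum_map_mul_right]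

lemma sum_unmarked {A : Type*} [CommRing A] (c : PForest) :
    (c.markings.map fun m => if m.unmarked then (1 : A) else 0).sum = 1 := by
  induction c with
  | nil => simp [PForest.markings, MForest.unmarked]
  | cons c r ihc ihr =>
    rw [sum_markings_cons]
    have h (m n : MForest) : (if (MForest.cons false m n).unmarked then (1 : A) else 0) =
        (if m.unmarked then (1 : A) else 0) * (if n.unmarked then (1 : A) else 0) := by
      cases hm : m.unmarked <;> cases hn : n.unmarked <;> simp [MForest.unmarked, hm, hn]
    simp only [h, sum_mul_sum, ihc, ihr]
    simp [MForest.unmarked]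

variable (k) in
/-- The coproduct of the tree `B₊(c)`: the sum, over the total cut and all admissible cuts, of
the pruning tensor the trunk. -/
def coprodTree (c : PForest) : HCK k ⊗[k] HCK k :=
  HCK.tree (RTree.mk c) ⊗ₜ[k] 1 +
    (c.cuts.map fun m => HCK.forest m.pruning ⊗ₜ[k] HCK.tree (RTree.mk m.trunk)).sum

variable (k) in
/-- Auxiliary sum: the coproduct of the forest `c`. -/
def coprodForest (c : PForest) : HCK k ⊗[k] HCK k :=
  (c.cuts.map fun m => HCK.forest m.pruning ⊗ₜ[k] HCK.forest m.trunk).sum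

lemma coprodTree_eq (c : PForest) : coprodTree k c = HCK.tree (RTree.mk c) ⊗ₜ[k] 1 +
    (bPlus k).lTensor (HCK k) (coprodForest k c) := by
  rw [coprodTree, coprodForest, map_list_sum, List.map_map]
  simp [Function.comp_def, bPlus_forest]

lemma coprodForest_nil : coprodForest k .nil = 1 := by
  simp only [coprodForest, PForest.cuts, PForest.markings, sum_filter_map]
  simp [MForest.admissible, MForest.pruning, MForest.trunk, HCK.forest,
    Algebra.TensorProduct.one_def]

lemma coprodForest_cons (c r : PForest) :
    coprodForest k (.cons c r) = coprodTree k c * coprodForest k r := by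
  rw [coprodTree, add_mul, coprodForest, coprodForest, PForest.cuts, PForest.cuts, PForest.cuts,
    sum_filter_map, sum_filter_map, sum_filter_map, sum_markings_cons, ← sum_mul_sum]
  congr 1
  · have h : ∀ m ∈ c.markings, ∀ n,
        (if (MForest.cons true m n).admissible then HCK.forest (MForest.cons true m n).pruning ⊗ₜ[k]
          HCK.forest (MForest.cons true m n).trunk else (0 : HCK k ⊗[k] HCK k)) =
        (if m.unmarked then (1 : HCK k ⊗[k] HCK k) else 0) *
        ((HCK.tree (RTree.mk c) ⊗ₜ[k] 1) * if n.admissible then HCK.forest n.pruning ⊗ₜ[k]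
          HCK.forest n.trunk else (0 : HCK k ⊗[k] HCK k)) := by
      intro m hm n
      cases h1 : m.unmarked <;> cases h2 : n.admissible <;>
        simp [MForest.admissible, h1, h2, MForest.pruning, MForest.trunk, HCK.forest,
          erase_of_mem_markings c m hm]
    rw [List.map_congr_left fun m hm => congrArg List.sum (List.map_congr_left fun n _ => h m hm n),
      sum_mul_sum, sum_unmarked, one_mul, List.sum_map_mul_left]
  · have h (m n : MForest) :
        (if (MForest.cons false m n).admissible then
          HCK.forest (MForest.cons false m n).pruning ⊗ₜ[k]
          HCK.forest (MForest.cons false m n).trunk else (0 : HCK k ⊗[k] HCK k)) =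
        (if m.admissible then HCK.forest m.pruning ⊗ₜ[k]
          HCK.tree (RTree.mk m.trunk) else (0 : HCK k ⊗[k] HCK k)) *
        if n.admissible then HCK.forest n.pruning ⊗ₜ[k]
          HCK.forest n.trunk else (0 : HCK k ⊗[k] HCK k) := by
      cases h1 : m.admissible <;> cases h2 : n.admissible <;>
        simp [MForest.admissible, h1, h2, MForest.pruning, MForest.trunk, HCK.forest,
          HCK.forest_append]
    simp only [h]

lemma coprodForest_move {c d : PForest} (h : PForest.Move c d) :
    coprodForest k c = coprodForest k d := by
  induction h with
  | swap c d r => simp only [coprodForest_cons]; ring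
  | branches r h ih =>
    rw [coprodForest_cons, coprodForest_cons, coprodTree_eq, coprodTree_eq, ih, RTree.mk_eq h]
  | rest c h ih => rw [coprodForest_cons, coprodForest_cons, ih]

lemma coprodTree_move {c d : PForest} (h : PForest.Move c d) :
    coprodTree k c = coprodTree k d := by
  rw [coprodTree_eq, coprodTree_eq, coprodForest_move h, RTree.mk_eq h]

namespace HCK

variable (k) in
/-- The Connes–Kreimer coproduct. -/
def comulHom : HCK k →ₐ[k] HCK k ⊗[k] HCK k :=
  lift (Quot.lift (coprodTree k) fun _ _ h => coprodTree_move h)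

variable (k) in
/-- The counit of the Connes–Kreimer algebra: it vanishes on all trees. -/
def counitHom : HCK k →ₐ[k] k := lift fun _ => 0

lemma comulHom_tree (c : PForest) : comulHom k (tree (RTree.mk c)) = coprodTree k c :=
  lift_tree _ _

lemma comulHom_forest (c : PForest) : comulHom k (forest c) = coprodForest k c := by
  induction c with
  | nil => rw [forest, map_one, coprodForest_nil]
  | cons c r _ ih => rw [forest, map_mul, comulHom_tree, ih, coprodForest_cons]

lemma comulHom_bPlus (x : HCK k) : comulHom k (bPlus k x) =
    bPlus k x ⊗ₜ[k] 1 + (bPlus k).lTensor (HCK k) (comulHom k x) := by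
  have : (comulHom k).toLinearMap ∘ₗ bPlus k = ((TensorProduct.mk k (HCK k) (HCK k)).flip 1) ∘ₗ
      bPlus k + (bPlus k).lTensor (HCK k) ∘ₗ (comulHom k).toLinearMap := by
    refine linearMap_ext fun c => ?_
    simp [bPlus_forest, comulHom_tree, comulHom_forest, coprodTree_eq]
  exact LinearMap.congr_fun this x

lemma counitHom_bPlus (x : HCK k) : counitHom k (bPlus k x) = 0 := by
  have : (counitHom k).toLinearMap ∘ₗ bPlus k = 0 := by
    refine linearMap_ext fun c => ?_
    simp [bPlus_forest, counitHom]
  exact LinearMap.congr_fun this x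

/-- Induction on the number of vertices: an identity of algebra morphisms can be checked on
`B₊(c)` once it is known on the forest `c`. -/
lemma algHom_ext_bPlus {A : Type*} [Semiring A] [Algebra k A] {g h : HCK k →ₐ[k] A}
    (H : ∀ x, g x = h x → g (bPlus k x) = h (bPlus k x)) : g = h := by
  have key : ∀ c : PForest, g (forest c) = h (forest c) := by
    intro c
    induction c with
    | nil => simp [forest]
    | cons c r ihc ihr => rw [forest, map_mul, map_mul, ihr, ← bPlus_forest, H _ ihc]
  refine algHom_ext fun t => ?_
  obtain ⟨c, rfl⟩ := Quot.exists_rep t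
  exact bPlus_forest (k := k) c ▸ H _ (key c)

open Algebra.TensorProduct in
lemma comulHom_coassoc :
    (Algebra.TensorProduct.assoc k k k (HCK k) (HCK k) (HCK k)).toAlgHom.comp
      ((map (comulHom k) (AlgHom.id k (HCK k))).comp (comulHom k)) =
    (map (AlgHom.id k (HCK k)) (comulHom k)).comp (comulHom k) := by
  refine algHom_ext_bPlus fun x hx => ?_
  have h1 : ∀ y : HCK k ⊗[k] HCK k,
      map (comulHom k) (AlgHom.id k (HCK k)) ((bPlus k).lTensor (HCK k) y) =
      (bPlus k).lTensor (HCK k ⊗[k] HCK k) (map (comulHom k) (AlgHom.id k (HCK k)) y) := by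
    intro y
    induction y with
    | zero => simp
    | add a b ha hb => simp only [map_add, ha, hb]
    | tmul a b => simp
  have h2 : ∀ y : (HCK k ⊗[k] HCK k) ⊗[k] HCK k,
      Algebra.TensorProduct.assoc k k k (HCK k) (HCK k) (HCK k)
        ((bPlus k).lTensor (HCK k ⊗[k] HCK k) y) =
      ((bPlus k).lTensor (HCK k)).lTensor (HCK k)
        (Algebra.TensorProduct.assoc k k k (HCK k) (HCK k) (HCK k) y) := by
    intro y
    induction y with
    | zero => simp
    | add a b ha hb => simp only [map_add, ha, hb]
    | tmul a b =>
      induction a with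
      | zero => simp
      | add a b ha hb => simp only [TensorProduct.add_tmul, map_add, ha, hb]
      | tmul a b => simp
  have h3 : ∀ y : HCK k ⊗[k] HCK k,
      map (AlgHom.id k (HCK k)) (comulHom k) ((bPlus k).lTensor (HCK k) y) =
      Algebra.TensorProduct.assoc k k k (HCK k) (HCK k) (HCK k)
        ((bPlus k).lTensor (HCK k) y ⊗ₜ[k] 1) +
      ((bPlus k).lTensor (HCK k)).lTensor (HCK k)
        (map (AlgHom.id k (HCK k)) (comulHom k) y) := by
    intro y
    induction y with
    | zero => simp
    | add a b ha hb =>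
      simp only [map_add, ha, hb, TensorProduct.add_tmul]
      abel
    | tmul a b => simp [comulHom_bPlus, TensorProduct.tmul_add]
  have hx' : Algebra.TensorProduct.assoc k k k (HCK k) (HCK k) (HCK k)
      (map (comulHom k) (AlgHom.id k (HCK k)) (comulHom k x)) =
      map (AlgHom.id k (HCK k)) (comulHom k) (comulHom k x) := hx
  change Algebra.TensorProduct.assoc k k k (HCK k) (HCK k) (HCK k)
      (map (comulHom k) (AlgHom.id k (HCK k)) (comulHom k (bPlus k x))) =
      map (AlgHom.id k (HCK k)) (comulHom k) (comulHom k (bPlus k x))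
  rw [comulHom_bPlus, map_add, map_add, map_add, h1, h2, h3, ← hx', map_tmul, map_tmul,
    comulHom_bPlus, TensorProduct.add_tmul, map_add]
  simp [one_def, add_assoc]

open Algebra.TensorProduct in
lemma rTensor_counitHom :
    (map (counitHom k) (AlgHom.id k (HCK k))).comp (comulHom k) =
      (Algebra.TensorProduct.lid k (HCK k)).symm.toAlgHom := by
  refine algHom_ext_bPlus fun x hx => ?_
  have h1 : ∀ y : HCK k ⊗[k] HCK k,
      map (counitHom k) (AlgHom.id k (HCK k)) ((bPlus k).lTensor (HCK k) y) =
      (bPlus k).lTensor k (map (counitHom k) (AlgHom.id k (HCK k)) y) := by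
    intro y
    induction y with
    | zero => simp
    | add a b ha hb => simp only [map_add, ha, hb]
    | tmul a b => simp
  have hx' : map (counitHom k) (AlgHom.id k (HCK k)) (comulHom k x) = 1 ⊗ₜ[k] x := hx
  change map (counitHom k) (AlgHom.id k (HCK k)) (comulHom k (bPlus k x)) = 1 ⊗ₜ[k] bPlus k x
  rw [comulHom_bPlus, map_add, h1, hx']
  simp [counitHom_bPlus]

open Algebra.TensorProduct in
lemma lTensor_counitHom :
    (map (AlgHom.id k (HCK k)) (counitHom k)).comp (comulHom k) =
      (Algebra.TensorProduct.rid k k (HCK k)).symm.toAlgHom := by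
  refine algHom_ext_bPlus fun x _ => ?_
  have h1 : ∀ y : HCK k ⊗[k] HCK k,
      map (AlgHom.id k (HCK k)) (counitHom k) ((bPlus k).lTensor (HCK k) y) = 0 := by
    intro y
    induction y with
    | zero => simp
    | add a b ha hb => simp only [map_add, ha, hb, add_zero]
    | tmul a b => simp [counitHom_bPlus]
  change map (AlgHom.id k (HCK k)) (counitHom k) (comulHom k (bPlus k x)) = bPlus k x ⊗ₜ[k] 1
  rw [comulHom_bPlus, map_add, h1]
  simp

instance : Bialgebra k (HCK k) :=
  Bialgebra.ofAlgHom (comulHom k) (counitHom k) comulHom_coassoc rTensor_counitHom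
    lTensor_counitHom

/-! ### The antipode -/

open WithConv

/-- The span of the `a ⊗ y` with `a` a forest with less than `n` vertices. -/
def lowSpan (n : ℕ) : Submodule k (HCK k ⊗[k] HCK k) :=
  Submodule.span k {z | ∃ (c : PForest) (y : HCK k), c.size < n ∧ z = forest c ⊗ₜ[k] y}

lemma tmul_mem_lowSpan {n : ℕ} (c : PForest) (y : HCK k) (h : c.size < n) :
    forest c ⊗ₜ[k] y ∈ lowSpan (k := k) n := Submodule.subset_span ⟨c, y, h, rfl⟩

lemma lowSpan_mono {n m : ℕ} (h : n ≤ m) : lowSpan (k := k) n ≤ lowSpan m :=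
  Submodule.span_mono fun _ ⟨c, y, hc, hz⟩ => ⟨c, y, hc.trans_le h, hz⟩

lemma size_append (c d : PForest) : (c.append d).size = c.size + d.size := by
  induction c with
  | nil => simp [PForest.append, PForest.size]
  | cons c r _ ih => simp only [PForest.append, PForest.size, ih]; omega

lemma mul_mem_lowSpan {n m : ℕ} {z w : HCK k ⊗[k] HCK k} (hz : z ∈ lowSpan n)
    (hw : w ∈ lowSpan (m + 1)) : z * w ∈ lowSpan (n + m) := by
  induction hz using Submodule.span_induction with
  | zero => simp
  | add a b _ _ ha hb => rw [add_mul]; exact add_mem ha hb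
  | smul r a _ ha => rw [smul_mul_assoc]; exact Submodule.smul_mem _ _ ha
  | mem z hz =>
    obtain ⟨c, y, hc, rfl⟩ := hz
    induction hw using Submodule.span_induction with
    | zero => simp
    | add a b _ _ ha hb => rw [mul_add]; exact add_mem ha hb
    | smul r a _ ha => rw [mul_smul_comm]; exact Submodule.smul_mem _ _ ha
    | mem w hw =>
      obtain ⟨d, y', hd, rfl⟩ := hw
      rw [Algebra.TensorProduct.tmul_mul_tmul, ← forest_append]
      exact tmul_mem_lowSpan _ _ (by rw [size_append]; omega)

lemma lTensor_mem_lowSpan {n : ℕ} {z : HCK k ⊗[k] HCK k} (hz : z ∈ lowSpan n) :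
    (bPlus k).lTensor (HCK k) z ∈ lowSpan n := by
  induction hz using Submodule.span_induction with
  | zero => simp
  | add a b _ _ ha hb => rw [map_add]; exact add_mem ha hb
  | smul r a _ ha => rw [map_smul]; exact Submodule.smul_mem _ _ ha
  | mem z hz =>
    obtain ⟨c, y, hc, rfl⟩ := hz
    exact tmul_mem_lowSpan _ _ hc

lemma comulHom_forest_sub (c : PForest) :
    comulHom k (forest c) - forest c ⊗ₜ[k] 1 ∈ lowSpan c.size := by
  induction c with
  | nil => simp [forest, Algebra.TensorProduct.one_def]
  | cons c r ihc ihr =>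
    have hc : comulHom k (forest c) ∈ lowSpan (k := k) (c.size + 1) := by
      rw [← sub_add_cancel (comulHom k (forest c)) (forest c ⊗ₜ[k] 1)]
      exact add_mem (lowSpan_mono (Nat.le_succ _) ihc)
        (tmul_mem_lowSpan _ _ (Nat.lt_succ_self _))
    set w := comulHom k (forest r) - forest r ⊗ₜ[k] 1 with hw
    have hr : comulHom k (forest r) = forest r ⊗ₜ[k] 1 + w := by rw [hw]; abel
    have ht : (tree (RTree.mk c) : HCK k) = forest (.cons c .nil) := by simp [forest]
    have e : comulHom k (forest (.cons c r)) - forest (.cons c r) ⊗ₜ[k] 1 =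
        w * (tree (RTree.mk c) ⊗ₜ[k] 1) +
        (bPlus k).lTensor (HCK k) (comulHom k (forest c)) * comulHom k (forest r) := by
      rw [forest, map_mul, ← bPlus_forest, comulHom_bPlus, add_mul, hr, mul_add,
        Algebra.TensorProduct.tmul_mul_tmul, mul_one, mul_comm w]
      abel
    rw [e, PForest.size]
    refine add_mem ?_ ?_
    · refine lowSpan_mono (le_of_eq ?_) (mul_mem_lowSpan ihr (m := c.size + 1) ?_)
      · omega
      · rw [ht]
        exact tmul_mem_lowSpan _ _ (by simp [PForest.size])
    · refine mul_mem_lowSpan (lTensor_mem_lowSpan hc) ?_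
      rw [hr]
      exact add_mem (tmul_mem_lowSpan _ _ (Nat.lt_succ_self _))
        (lowSpan_mono (Nat.le_succ _) ihr)

lemma comulHom_forest_mem (c : PForest) :
    comulHom k (forest c) ∈ lowSpan (k := k) (c.size + 1) := by
  rw [← sub_add_cancel (comulHom k (forest c)) (forest c ⊗ₜ[k] 1)]
  exact add_mem (lowSpan_mono (Nat.le_succ _) (comulHom_forest_sub c))
    (tmul_mem_lowSpan _ _ (Nat.lt_succ_self _))

lemma conv_apply (f g : WithConv (HCK k →ₗ[k] HCK k)) (x : HCK k) :
    (f * g).ofConv x =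
      LinearMap.mul' k (HCK k) (TensorProduct.map f.ofConv g.ofConv (comulHom k x)) := rfl

lemma map_eq_of_mem_lowSpan {n : ℕ} {f f' : HCK k →ₗ[k] HCK k} (g : HCK k →ₗ[k] HCK k)
    (h : ∀ c : PForest, c.size < n → f (forest c) = f' (forest c)) {z : HCK k ⊗[k] HCK k}
    (hz : z ∈ lowSpan n) : TensorProduct.map f g z = TensorProduct.map f' g z := by
  induction hz using Submodule.span_induction with
  | zero => simp
  | add a b _ _ ha hb => rw [map_add, map_add, ha, hb]
  | smul r a _ ha => rw [map_smul, map_smul, ha]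
  | mem z hz =>
    obtain ⟨c, y, hc, rfl⟩ := hz
    rw [TensorProduct.map_tmul, TensorProduct.map_tmul, h c hc]

/-- A linear map that vanishes on `1` is locally nilpotent for the convolution product. -/
lemma conv_pow_forest (J : WithConv (HCK k →ₗ[k] HCK k)) (hJ : J.ofConv 1 = 0) (n : ℕ) :
    ∀ c : PForest, c.size < n → (J ^ n).ofConv (forest c) = 0 := by
  induction n with
  | zero => intro c hc; omega
  | succ n ih =>
    intro c hc
    rw [pow_succ, conv_apply,
      ← sub_add_cancel (comulHom k (forest c)) (forest c ⊗ₜ[k] 1), map_add,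
      map_eq_of_mem_lowSpan (n := c.size) (f' := 0) _
        (fun d hd => ih d (by omega)) (comulHom_forest_sub c)]
    simp [hJ]

/-- The number of vertices of a monomial. -/
def weight (s : RTree →₀ ℕ) : ℕ := Finsupp.weight RTree.vertices s

open Classical in
lemma weight_forest (c : PForest) :
    weight (Multiset.toFinsupp (c.toList.map RTree.mk : List RTree)) = c.size := by
  induction c with
  | nil => rfl
  | cons c r _ ih =>
    rw [PForest.toList, List.map_cons, ← Multiset.cons_coe, ← Multiset.singleton_add, map_add,
      Multiset.toFinsupp_singleton, weight, map_add]
    rw [weight] at ih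
    rw [ih, Finsupp.weight_single, one_smul]
    rfl

lemma exists_conv_inverse (T : WithConv (HCK k →ₗ[k] HCK k)) (hT : T.ofConv 1 = 1) :
    ∃ S : WithConv (HCK k →ₗ[k] HCK k), S * T = 1 ∧ S.ofConv 1 = 1 := by
  classical
  set J := 1 - T with hJdef
  have hone : (1 : WithConv (HCK k →ₗ[k] HCK k)).ofConv 1 = 1 := by
    rw [LinearMap.convOne_def]
    change algebraMap k (HCK k) (counitHom k 1) = 1
    simp
  have hJ : J.ofConv 1 = 0 := by
    rw [hJdef, WithConv.ofConv_sub, LinearMap.sub_apply, hone, hT, sub_self]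
  let P : ℕ → WithConv (HCK k →ₗ[k] HCK k) := fun n => ∑ i ∈ Finset.range (n + 1), J ^ i
  let S : HCK k →ₗ[k] HCK k := (MvPolynomial.basisMonomials RTree k).constr k
    fun s => (P (weight s)).ofConv (MvPolynomial.monomial s (1 : k))
  have hS0 : ∀ c : PForest, S (forest c) = (P c.size).ofConv (forest c) := by
    intro c
    have := (MvPolynomial.basisMonomials RTree k).constr_basis k
      (fun s => (P (weight s)).ofConv (MvPolynomial.monomial s (1 : k)))
      (Multiset.toFinsupp (c.toList.map RTree.mk : List RTree))
    rw [MvPolynomial.coe_basisMonomials, weight_forest, ← forest_eq] at this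
    rw [← this, forest_eq]
    rfl
  have hP : ∀ n m (c : PForest), c.size ≤ n →
      (P (n + m)).ofConv (forest c) = (P n).ofConv (forest c) := by
    intro n m c hc
    induction m with
    | zero => rfl
    | succ m ih =>
      rw [← ih]
      change (∑ i ∈ Finset.range (n + m + 1 + 1), J ^ i).ofConv _ = _
      rw [Finset.sum_range_succ, WithConv.ofConv_add, LinearMap.add_apply,
        conv_pow_forest J hJ _ c (by omega), add_zero]
  have hS : ∀ n (c : PForest), c.size < n + 1 → S (forest c) = (P n).ofConv (forest c) := by
    intro n c hc
    obtain ⟨m, rfl⟩ := Nat.exists_eq_add_of_le (Nat.lt_succ_iff.1 hc)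
    rw [hS0, hP _ _ _ le_rfl]
  have hST : toConv S * T = 1 := by
    refine WithConv.ofConv_injective (linearMap_ext fun c => ?_)
    rw [conv_apply, map_eq_of_mem_lowSpan (n := c.size + 1) _ (hS c.size) (comulHom_forest_mem c),
      ← conv_apply]
    have : P c.size * T = 1 - J ^ (c.size + 1) := by
      have hT' : T = 1 - J := by rw [hJdef]; abel
      rw [hT']
      exact geom_sum_mul_neg J _
    rw [this, WithConv.ofConv_sub, LinearMap.sub_apply,
      conv_pow_forest J hJ _ c (Nat.lt_succ_self _), sub_zero]
  refine ⟨toConv S, hST, ?_⟩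
  have := LinearMap.congr_fun (congrArg WithConv.ofConv hST) (1 : HCK k)
  rw [conv_apply, hone, map_one] at this
  simpa [Algebra.TensorProduct.one_def, hT] using this

variable (k) in
lemma exists_antipode : ∃ S : WithConv (HCK k →ₗ[k] HCK k),
    S * toConv LinearMap.id = 1 ∧ toConv LinearMap.id * S = 1 := by
  obtain ⟨S, hS, hS1⟩ := exists_conv_inverse (k := k) (toConv LinearMap.id) rfl
  obtain ⟨S', hS', -⟩ := exists_conv_inverse S hS1
  have : S' = toConv LinearMap.id := left_inv_eq_right_inv hS' hS
  exact ⟨S, hS, this ▸ hS'⟩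

/-- The Connes–Kreimer Hopf algebra. -/
instance : HopfAlgebra k (HCK k) where
  antipode := (exists_antipode k).choose.ofConv
  mul_antipode_rTensor_comul :=
    congrArg WithConv.ofConv (exists_antipode k).choose_spec.1
  mul_antipode_lTensor_comul :=
    congrArg WithConv.ofConv (exists_antipode k).choose_spec.2

end HCK

/-! ### The coaction of `𝓗` on the Connes–Kreimer Hopf algebra -/

variable (k) in
/-- The value of the coaction on the tree `t = B₊(c)`: the sum of `s ⊗ t/s` over the subforests
`s` of `t`. A subforest, i.e. a family of disjoint subtrees with at least one edge each, is given
by its set of edges. -/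
def coactTree (c : PForest) : HCon k ⊗[k] HCK k :=
  (c.markings.map fun m => HCon.forest m.components ⊗ₜ[k] HCK.tree (RTree.mk m.contract)).sum

/-- The algebra morphism that identifies the one-vertex tree with the unit. -/
def toHCon : HCK k →ₐ[k] HCon k := HCK.lift HCon.tree

variable (k) in
/-- Auxiliary sum, which keeps track of the component of the root. -/
def coactAux (c : PForest) : HCK k ⊗[k] (HCon k ⊗[k] HCK k) :=
  (c.markings.map fun m => HCK.forest m.rootComponent ⊗ₜ[k]
    (HCon.forest m.otherComponents ⊗ₜ[k] HCK.forest m.contract)).sum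

variable (k) in
/-- Auxiliary map `x ⊗ h ⊗ y ↦ B₊(x) h ⊗ B₊(y)`. -/
def coactClose : HCK k ⊗[k] (HCon k ⊗[k] HCK k) →ₗ[k] HCon k ⊗[k] HCK k :=
  LinearMap.mul' k (HCon k ⊗[k] HCK k) ∘ₗ
    TensorProduct.map ((TensorProduct.mk k (HCon k) (HCK k)).flip 1 ∘ₗ toHCon.toLinearMap ∘ₗ
      bPlus k) ((bPlus k).lTensor (HCon k))

lemma coactTree_eq (c : PForest) : coactTree k c = coactClose k (coactAux k c) := by
  rw [coactTree, coactAux, map_list_sum, List.map_map]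
  refine congrArg List.sum (List.map_congr_left fun m _ => ?_)
  simp [coactClose, bPlus_forest, MForest.components, HCon.forest, toHCon]

lemma coactAux_cons (c r : PForest) : coactAux k (.cons c r) =
    ((bPlus k).rTensor _ (coactAux k c) + 1 ⊗ₜ[k] coactTree k c) * coactAux k r := by
  have h1 : (bPlus k).rTensor _ (coactAux k c) =
      (c.markings.map fun m => HCK.tree (RTree.mk m.rootComponent) ⊗ₜ[k]
    (HCon.forest m.otherComponents ⊗ₜ[k] HCK.forest m.contract)).sum := by
    rw [coactAux, map_list_sum, List.map_map]
    simp [Function.comp_def, bPlus_forest]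
  have h2 : (1 : HCK k) ⊗ₜ[k] coactTree k c =
      (c.markings.map fun m => (1 : HCK k) ⊗ₜ[k] (HCon.forest m.components ⊗ₜ[k]
        HCK.tree (RTree.mk m.contract))).sum := by
    change TensorProduct.mk k _ _ 1 _ = _
    rw [coactTree, map_list_sum, List.map_map]
    simp [Function.comp_def]
  rw [add_mul, h1, h2, coactAux, coactAux, sum_markings_cons, ← sum_mul_sum, ← sum_mul_sum]
  simp [MForest.rootComponent, MForest.otherComponents, MForest.contract, MForest.components,
    HCK.forest, HCon.forest, HCK.forest_append, HCon.forest_append, mul_assoc]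

lemma coactAux_move {c d : PForest} (h : PForest.Move c d) : coactAux k c = coactAux k d := by
  induction h with
  | swap c d r => simp only [coactAux_cons]; ring
  | branches r h ih => simp only [coactAux_cons, coactTree_eq, ih]
  | rest c h ih => simp only [coactAux_cons, ih]

variable (k) in
/-- The left coaction `Φ`, extended from trees to an algebra morphism. -/
def coaction : HCK k →ₐ[k] HCon k ⊗[k] HCK k :=
  HCK.lift (Quot.lift (coactTree k) fun _ _ h => by
    rw [coactTree_eq, coactTree_eq, coactAux_move h])

/-! ### Characters, operators, biderivations -/

/-- Infinitesimal characters of `𝓗`. -/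
def IsInfinitesimalCharacter (a : HCon k →ₗ[k] k) : Prop :=
  ∀ x y, a (x * y) = a x * HCon.counit y + HCon.counit x * a y

/-- The operator `(a ⊗ Id) ∘ Φ`. -/
def transposeL (a : HCon k →ₗ[k] k) : HCK k →ₗ[k] HCK k :=
  (TensorProduct.lid k (HCK k)).toLinearMap ∘ₗ TensorProduct.map a LinearMap.id ∘ₗ
    (coaction k).toLinearMap

/-- The operator `L_a : b ↦ a ⋆ b = (a ⊗ b) ∘ Φ` on linear forms. -/
def leftMul (a : HCon k →ₗ[k] k) : Module.Dual k (HCK k) →ₗ[k] Module.Dual k (HCK k) where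
  toFun b := LinearMap.mul' k k ∘ₗ TensorProduct.map a b ∘ₗ (coaction k).toLinearMap
  map_add' b c := by simp only [TensorProduct.map_add_right, LinearMap.add_comp, LinearMap.comp_add]
  map_smul' r b := by
    simp only [TensorProduct.map_smul_right, LinearMap.smul_comp, LinearMap.comp_smul,
      RingHom.id_apply]

section Bialgebra

variable {C : Type*} [CommRing C]

/-- Biderivations of a bialgebra: derivations that are coderivations. -/
structure IsBiderivation [Bialgebra k C] (D : C →ₗ[k] C) : Prop where
  leibniz : ∀ x y, D (x * y) = D x * y + x * D y
  coleibniz : Coalgebra.comul ∘ₗ D =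
    (TensorProduct.map D LinearMap.id + TensorProduct.map LinearMap.id D) ∘ₗ Coalgebra.comul

/-- The convolution product of linear forms. -/
def conv [Bialgebra k C] (b c : Module.Dual k C) : Module.Dual k C :=
  (WithConv.toConv b * WithConv.toConv c).ofConv

/-- The coproduct of the complete dual: the transpose of the product, with values in the completed
tensor square `(C ⊗ C)*` of `C*`. -/
def dualComul [Algebra k C] : Module.Dual k C →ₗ[k] Module.Dual k (C ⊗[k] C) :=
  (LinearMap.mul' k C).dualMap

/-- The completed tensor product, on `(C ⊗ C)*`, of the transposes of `f` and `g`. -/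
def dualTensor [Algebra k C] (f g : C →ₗ[k] C) :
    Module.Dual k (C ⊗[k] C) →ₗ[k] Module.Dual k (C ⊗[k] C) :=
  (TensorProduct.map f g).dualMap

/-- `L` is a biderivation of the complete dual `C*`, where `T` is the operator on `C` of which `L`
is the transpose, so that `L` is continuous and `L ⊗ Id` acts on the completed tensor square. -/
structure IsDualBiderivation [Bialgebra k C] (T : C →ₗ[k] C)
    (L : Module.Dual k C →ₗ[k] Module.Dual k C) : Prop where
  transpose : L = T.dualMap
  leibniz : ∀ b c, L (conv b c) = conv (L b) c + conv b (L c)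
  coleibniz : ∀ b, dualComul (L b) =
    dualTensor T LinearMap.id (dualComul b) + dualTensor LinearMap.id T (dualComul b)

/-- `L` is an automorphism of the complete Hopf algebra `C*`, where `T` is the operator on `C` of
which `L` is the transpose. The unit of `C*` is the counit of `C`, the counit of `C*` is the
evaluation at `1`, and the antipode of `C*` is the transpose of the antipode of `C`. -/
structure IsDualAutomorphism [HopfAlgebra k C] (T : C →ₗ[k] C)
    (L : Module.Dual k C →ₗ[k] Module.Dual k C) : Prop where
  transpose : L = T.dualMap
  bijective : Function.Bijective L
  map_conv : ∀ b c, L (conv b c) = conv (L b) (L c)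
  map_unit : L Coalgebra.counit = Coalgebra.counit
  map_comul : ∀ b, dualComul (L b) = dualTensor T T (dualComul b)
  map_counit : ∀ b, L b 1 = b 1
  map_antipode : ∀ b, L (b ∘ₗ HopfAlgebra.antipode k) = L b ∘ₗ HopfAlgebra.antipode k

end Bialgebra

/-! ### Graded duals -/

/-- Homogeneous elements of the Connes–Kreimer algebra, graded by the number of vertices. -/
def HCK.IsHomogeneous (x : HCK k) (n : ℕ) : Prop :=
  MvPolynomial.IsWeightedHomogeneous (R := k) RTree.vertices x n

/-- Homogeneous elements of `𝓗`, graded by the number of edges. -/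
def HCon.IsHomogeneous (x : HCon k) (n : ℕ) : Prop :=
  MvPolynomial.IsWeightedHomogeneous (R := k)
    (fun t : {t : RTree // t ≠ RTree.bullet} => t.1.edges) x n

variable (k) in
/-- The graded dual of the Connes–Kreimer algebra: the linear forms that vanish in all large
degrees. -/
def HCK.gradedDual : Submodule k (Module.Dual k (HCK k)) where
  carrier := {b | ∃ N, ∀ n ≥ N, ∀ x, HCK.IsHomogeneous x n → b x = 0}
  zero_mem' := ⟨0, fun _ _ _ _ => rfl⟩
  add_mem' := by
    rintro b c ⟨N, hN⟩ ⟨M, hM⟩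
    refine ⟨max N M, fun n hn x hx => ?_⟩
    rw [LinearMap.add_apply, hN n (le_of_max_le_left hn) x hx,
      hM n (le_of_max_le_right hn) x hx, add_zero]
  smul_mem' := by
    rintro r b ⟨N, hN⟩
    refine ⟨N, fun n hn x hx => ?_⟩
    rw [LinearMap.smul_apply, hN n hn x hx, smul_zero]

/-- Membership in the graded dual of `𝓗`. -/
def HCon.MemGradedDual (a : HCon k →ₗ[k] k) : Prop :=
  ∃ N, ∀ n ≥ N, ∀ x, HCon.IsHomogeneous x n → a x = 0

variable (k) in
/-- The canonical map from the tensor square of the graded dual of the Connes–Kreimer algebra to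
the linear forms on its tensor square. -/
def gradedDualPairing : HCK.gradedDual k ⊗[k] HCK.gradedDual k →ₗ[k]
    Module.Dual k (HCK k ⊗[k] HCK k) :=
  TensorProduct.dualDistrib k (HCK k) (HCK k) ∘ₗ
    TensorProduct.map (HCK.gradedDual k).subtype (HCK.gradedDual k).subtype

/-- `L` maps the graded dual of the Connes–Kreimer algebra to itself and is a biderivation of this
Hopf algebra, whose product is the convolution and whose coproduct, the transpose of the product,
takes its values in the tensor square of the graded dual. -/
def IsGradedDualBiderivation
    (L : Module.Dual k (HCK k) →ₗ[k] Module.Dual k (HCK k)) : Prop :=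
  ∃ hL : ∀ b ∈ HCK.gradedDual k, L b ∈ HCK.gradedDual k,
    (∀ b ∈ HCK.gradedDual k, ∀ c ∈ HCK.gradedDual k, conv b c ∈ HCK.gradedDual k ∧
      L (conv b c) = conv (L b) c + conv b (L c)) ∧
    ∀ b ∈ HCK.gradedDual k,
      (∃ z, gradedDualPairing k z = dualComul b) ∧
      ∀ z, gradedDualPairing k z = dualComul b →
        gradedDualPairing k ((L.restrict hL).rTensor _ z + (L.restrict hL).lTensor _ z) =
          dualComul (L b)

end

end ForestHopf

open ForestHopf

namespace ForestHopf

noncomputable section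

universe u

variable {k : Type u} [CommRing k]

/-! ### The coaction is compatible with the Connes–Kreimer coproduct -/

section compatibility

open Algebra.TensorProduct

/-! Two facts about `Φ` carry the theorem. The first, `map_comulHom_coaction`, is that `Δ` is a
morphism of comodules: `(Id ⊗ Δ) ∘ Φ` equals `Δ` followed by the coaction on the tensor square,
which multiplies the `𝓗`-legs of `Φ(y)` and `Φ(z)`. The second, `counitSlice_coaction`, is `(ε ⊗ Id)
∘ Φ = Id`. Apply `a ⊗ Id` to the first one. If `a` is a character, products of `𝓗`-legs become
products of values, so `ᵗL_a` respects product and coproduct. If `a` is infinitesimal, they become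
Leibniz sums in which the other factor only meets `ε`, hence is unchanged: `ᵗL_a` is a biderivation.

The first fact is proved by induction along `B₊`, using the cocycle identity `Δ(B₊(x)) = B₊(x) ⊗ 1 +
(Id ⊗ B₊)Δ(x)`. Since `Φ(x)` does not tell which subtrees get joined by the new root, the induction
runs on the refinement `Ψ = rootCoaction`, which stores the branches of the root component in an
extra leg. It satisfies `Φ(B₊(x)) = coactClose(Ψ(x))` and `Ψ(B₊(x)) = (B₊ ⊗ Id)Ψ(x) + 1 ⊗ Φ(B₊(x))`.
The refined compatibility is `rootCoaction_comul`: only the part under a cut contains the root, so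
`Ψ` acts on the second factor and `Φ` on the first.

For a character `φ`, bijectivity comes from the grading: `Φ` preserves the total degree and `𝓗` is
constant in degree zero, so `ᵗL_φ - Id` strictly lowers degrees and is locally nilpotent. As `L_a`
is the transpose of `ᵗL_a`, the statements on the complete dual follow by transposition; those on
the graded dual also use that there are finitely many forests in each degree. -/

lemma coaction_tree (c : PForest) : coaction k (HCK.tree (RTree.mk c)) = coactTree k c :=
  HCK.lift_tree _ _

variable (k) in
/-- The refinement of the coaction that keeps track of the component of the root, as an algebra
morphism. -/
def rootCoaction : HCK k →ₐ[k] HCK k ⊗[k] (HCon k ⊗[k] HCK k) :=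
  HCK.lift (Quot.lift (fun c => (bPlus k).rTensor _ (coactAux k c) + 1 ⊗ₜ[k] coactTree k c)
    fun _ _ h => by simp only [coactTree_eq, coactAux_move h])

lemma rootCoaction_tree (c : PForest) : rootCoaction k (HCK.tree (RTree.mk c)) =
    (bPlus k).rTensor _ (coactAux k c) + 1 ⊗ₜ[k] coactTree k c :=
  HCK.lift_tree _ _

lemma rootCoaction_forest (c : PForest) : rootCoaction k (HCK.forest c) = coactAux k c := by
  induction c with
  | nil =>
    simp [HCK.forest, coactAux, PForest.markings, MForest.rootComponent,
      MForest.otherComponents, MForest.contract, HCon.forest, one_def]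
  | cons c r _ ih => rw [HCK.forest, map_mul, rootCoaction_tree, ih, coactAux_cons]

/-- A set of edges of `B₊(c)` is what `Ψ(c)` sums over; closing puts the root back under the stored
branches and under the contracted forest. -/
lemma coaction_bPlus (x : HCK k) :
    coaction k (bPlus k x) = coactClose k (rootCoaction k x) := by
  have : (coaction k).toLinearMap ∘ₗ bPlus k =
      coactClose k ∘ₗ (rootCoaction k).toLinearMap := by
    refine HCK.linearMap_ext fun c => ?_
    simp [bPlus_forest, coaction_tree, rootCoaction_forest, coactTree_eq]
  exact LinearMap.congr_fun this x

/-- The edge from the root to the new branch `B₊(x)` is marked or not. If it is, the root component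
of the branch becomes a branch of the root component; if not, the branch contributes nothing to the
root component and its own subforests are counted by `Φ`. -/
lemma rootCoaction_bPlus (x : HCK k) : rootCoaction k (bPlus k x) =
    (bPlus k).rTensor _ (rootCoaction k x) + 1 ⊗ₜ[k] coaction k (bPlus k x) := by
  have : (rootCoaction k).toLinearMap ∘ₗ bPlus k =
      (bPlus k).rTensor _ ∘ₗ (rootCoaction k).toLinearMap +
        TensorProduct.mk k _ _ 1 ∘ₗ (coaction k).toLinearMap ∘ₗ bPlus k := by
    refine HCK.linearMap_ext fun c => ?_
    simp [bPlus_forest, coaction_tree, rootCoaction_forest, rootCoaction_tree]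
  exact LinearMap.congr_fun this x

lemma coactClose_tmul (x : HCK k) (h : HCon k) (y : HCK k) :
    coactClose k (x ⊗ₜ[k] (h ⊗ₜ[k] y)) = (toHCon (bPlus k x) * h) ⊗ₜ[k] bPlus k y := by
  simp [coactClose]

variable (k) in
/-- The map `h ⊗ y ↦ h ⊗ (y ⊗ 1)`. -/
def inclFst : HCon k ⊗[k] HCK k →ₐ[k] HCon k ⊗[k] (HCK k ⊗[k] HCK k) :=
  map (AlgHom.id k _) includeLeft

variable (k) in
/-- The map `h ⊗ y ↦ h ⊗ (1 ⊗ y)`. -/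
def inclSnd : HCon k ⊗[k] HCK k →ₐ[k] HCon k ⊗[k] (HCK k ⊗[k] HCK k) :=
  map (AlgHom.id k _) includeRight

@[simp] lemma inclFst_tmul (h : HCon k) (y : HCK k) :
    inclFst k (h ⊗ₜ[k] y) = h ⊗ₜ[k] (y ⊗ₜ[k] 1) := by simp [inclFst]

@[simp] lemma inclSnd_tmul (h : HCon k) (y : HCK k) :
    inclSnd k (h ⊗ₜ[k] y) = h ⊗ₜ[k] (1 ⊗ₜ[k] y) := by simp [inclSnd]

variable (k) in
/-- The coaction on the tensor square of the Connes–Kreimer algebra. -/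
def coactionSq : HCK k ⊗[k] HCK k →ₐ[k] HCon k ⊗[k] (HCK k ⊗[k] HCK k) :=
  productMap ((inclFst k).comp (coaction k)) ((inclSnd k).comp (coaction k))

/-- The map `x ⊗ y ↦ (1 ⊗ f(x)) g(y)`. -/
def mulSnd {A B X Y : Type*} [CommRing A] [CommRing B] [CommRing X] [CommRing Y] [Algebra k A]
    [Algebra k B] [Algebra k X] [Algebra k Y] (f : X →ₐ[k] B) (g : Y →ₐ[k] A ⊗[k] B) :
    X ⊗[k] Y →ₐ[k] A ⊗[k] B :=
  productMap (includeRight.comp f) g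

/-- With `mulLeft` the product is a linear map applied to the second factor, so it can be commuted
with linear maps such as `B₊` on one leg. -/
lemma mulSnd_tmul {A B X Y : Type*} [CommRing A] [CommRing B] [CommRing X] [CommRing Y]
    [Algebra k A] [Algebra k B] [Algebra k X] [Algebra k Y] (f : X →ₐ[k] B)
    (g : Y →ₐ[k] A ⊗[k] B) (x : X) (y : Y) :
    mulSnd f g (x ⊗ₜ[k] y) = LinearMap.mulLeft k (1 ⊗ₜ[k] f x) (g y) := by
  simp [mulSnd]

lemma mulLeft_one_tmul_add {A B : Type*} [CommRing A] [CommRing B] [Algebra k A] [Algebra k B]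
    (b c : B) : LinearMap.mulLeft k ((1 : A) ⊗ₜ[k] (b + c)) =
      LinearMap.mulLeft k (1 ⊗ₜ[k] b) + LinearMap.mulLeft k (1 ⊗ₜ[k] c) := by
  ext; simp [TensorProduct.tmul_add, add_mul]

lemma mulLeft_one_tmul_tmul {A B : Type*} [CommRing A] [CommRing B] [Algebra k A] [Algebra k B]
    (b c : B) (a : A) : LinearMap.mulLeft k ((1 : A) ⊗ₜ[k] b) (a ⊗ₜ[k] c) = a ⊗ₜ[k] (b * c) := by
  simp

variable (k) in
/-- The analogue of `coactionSq` that keeps track of the component of the root of the second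
factor. -/
def rootCoactionSq : HCK k ⊗[k] HCK k →ₐ[k] HCK k ⊗[k] (HCon k ⊗[k] (HCK k ⊗[k] HCK k)) :=
  mulSnd ((inclFst k).comp (coaction k))
    ((map (AlgHom.id k _) (inclSnd k)).comp (rootCoaction k))

variable (k) in
/-- The map `x ⊗ h ⊗ (y ⊗ z) ↦ B₊(x) h ⊗ (y ⊗ B₊(z))`. -/
def closeSnd : HCK k ⊗[k] (HCon k ⊗[k] (HCK k ⊗[k] HCK k)) →ₗ[k]
    HCon k ⊗[k] (HCK k ⊗[k] HCK k) :=
  LinearMap.mul' k _ ∘ₗ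
    TensorProduct.map ((TensorProduct.mk k (HCon k) (HCK k ⊗[k] HCK k)).flip 1 ∘ₗ
      toHCon.toLinearMap ∘ₗ bPlus k) (((bPlus k).lTensor (HCK k)).lTensor (HCon k))

lemma closeSnd_tmul (x : HCK k) (h : HCon k) (w : HCK k ⊗[k] HCK k) :
    closeSnd k (x ⊗ₜ[k] (h ⊗ₜ[k] w)) =
      (toHCon (bPlus k x) * h) ⊗ₜ[k] (bPlus k).lTensor (HCK k) w := by
  simp [closeSnd]

/-- Two linear maps on a triple tensor product agree if they agree on pure tensors. -/
lemma tensor_ext_threefold {A B C M : Type*} [AddCommGroup A] [AddCommGroup B] [AddCommGroup C]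
    [AddCommGroup M] [Module k A] [Module k B] [Module k C] [Module k M]
    {f g : A ⊗[k] (B ⊗[k] C) →ₗ[k] M}
    (H : ∀ a b c, f (a ⊗ₜ[k] (b ⊗ₜ[k] c)) = g (a ⊗ₜ[k] (b ⊗ₜ[k] c))) : f = g := by
  ext a b c
  exact H a b c

/-- This is the cocycle identity of `B₊` on the last leg: the total cut gives the `inclFst` term,
the other cuts keep the root in the second factor, where `closeSnd` grafts it. -/
lemma map_comulHom_coactClose (w : HCK k ⊗[k] (HCon k ⊗[k] HCK k)) :
    map (AlgHom.id k (HCon k)) (HCK.comulHom k) (coactClose k w) =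
      inclFst k (coactClose k w) +
        closeSnd k (map (AlgHom.id k (HCK k)) (map (AlgHom.id k (HCon k)) (HCK.comulHom k)) w) := by
  have : (map (AlgHom.id k (HCon k)) (HCK.comulHom k)).toLinearMap ∘ₗ coactClose k =
      (inclFst k).toLinearMap ∘ₗ coactClose k + closeSnd k ∘ₗ
        (map (AlgHom.id k (HCK k)) (map (AlgHom.id k (HCon k)) (HCK.comulHom k))).toLinearMap := by
    refine tensor_ext_threefold fun x h y => ?_
    simp [coactClose_tmul, closeSnd_tmul, HCK.comulHom_bPlus, TensorProduct.tmul_add]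
  exact LinearMap.congr_fun this w

/-- The part above a cut does not contain the root, so multiplying by its coaction before or after
grafting the root makes no difference. -/
lemma inclFst_mul_coactClose (p : HCon k ⊗[k] HCK k) (w : HCK k ⊗[k] (HCon k ⊗[k] HCK k)) :
    inclFst k p * inclSnd k (coactClose k w) = closeSnd k
      (LinearMap.mulLeft k (1 ⊗ₜ[k] inclFst k p) (map (AlgHom.id k (HCK k)) (inclSnd k) w)) := by
  induction p with
  | zero =>
    -- Additivity at `0 + 0` shows that multiplication by `1 ⊗ 0` vanishes.
    have h := mulLeft_one_tmul_add (k := k) (A := HCK k) (0 : HCon k ⊗[k] (HCK k ⊗[k] HCK k)) 0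
    rw [add_zero, left_eq_add] at h
    rw [map_zero, h, LinearMap.zero_apply, map_zero, zero_mul]
  | add p q hp hq =>
    rw [map_add, add_mul, hp, hq, mulLeft_one_tmul_add, LinearMap.add_apply, map_add]
  | tmul h y =>
    have : LinearMap.mulLeft k (inclFst k (h ⊗ₜ[k] y)) ∘ₗ (inclSnd k).toLinearMap ∘ₗ coactClose k =
        closeSnd k ∘ₗ LinearMap.mulLeft k ((1 : HCK k) ⊗ₜ[k] inclFst k (h ⊗ₜ[k] y)) ∘ₗ
          (map (AlgHom.id k (HCK k)) (inclSnd k)).toLinearMap := by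
      refine tensor_ext_threefold fun x h' y' => ?_
      simp only [LinearMap.comp_apply, AlgHom.toLinearMap_apply, map_tmul, AlgHom.id_apply,
        mulLeft_one_tmul_tmul]
      simp [coactClose_tmul, closeSnd_tmul, mul_left_comm]
    exact LinearMap.congr_fun this w

/-- The counterpart of `coaction_bPlus` on the tensor square, with the root in the second factor. -/
lemma coactionSq_lTensor_bPlus (w : HCK k ⊗[k] HCK k) :
    coactionSq k ((bPlus k).lTensor (HCK k) w) = closeSnd k (rootCoactionSq k w) := by
  induction w with
  | zero => simp
  | add p q hp hq => simp only [map_add, hp, hq]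
  | tmul y z =>
    rw [rootCoactionSq, mulSnd_tmul, LinearMap.lTensor_tmul, coactionSq, productMap_apply_tmul]
    simp only [AlgHom.comp_apply, coaction_bPlus, inclFst_mul_coactClose]

lemma map_rTensor {A B C : Type*} [CommRing A] [CommRing B] [CommRing C] [Algebra k A]
    [Algebra k B] [Algebra k C] (f : A →ₗ[k] A) (g : B →ₐ[k] C) (w : A ⊗[k] B) :
    map (AlgHom.id k A) g (f.rTensor B w) = f.rTensor C (map (AlgHom.id k A) g w) := by
  induction w with
  | zero => simp
  | add p q hp hq => simp only [map_add, hp, hq]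
  | tmul y z => simp

lemma mulLeft_one_tmul_rTensor {A B : Type*} [CommRing A] [CommRing B] [Algebra k A] [Algebra k B]
    (f : A →ₗ[k] A) (b : B) (w : A ⊗[k] B) :
    LinearMap.mulLeft k (1 ⊗ₜ[k] b) (f.rTensor B w) =
      f.rTensor B (LinearMap.mulLeft k (1 ⊗ₜ[k] b) w) := by
  induction w with
  | zero => simp
  | add p q hp hq => simp only [map_add, hp, hq]
  | tmul y z => simp

/-- The counterpart of `rootCoaction_bPlus` on the tensor square. The factor coming from `y` is
trivial on the leg of the root component, so it commutes with `B₊` there. -/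
lemma rootCoactionSq_lTensor_bPlus (w : HCK k ⊗[k] HCK k) :
    rootCoactionSq k ((bPlus k).lTensor (HCK k) w) =
      (bPlus k).rTensor _ (rootCoactionSq k w) +
        1 ⊗ₜ[k] coactionSq k ((bPlus k).lTensor (HCK k) w) := by
  induction w with
  | zero => simp
  | add p q hp hq =>
    simp only [map_add, hp, hq, TensorProduct.tmul_add]
    abel
  | tmul y z =>
    simp only [LinearMap.lTensor_tmul, rootCoactionSq, mulSnd_tmul, coactionSq,
      productMap_apply_tmul, AlgHom.comp_apply, rootCoaction_bPlus, map_add, map_rTensor,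
      mulLeft_one_tmul_rTensor, map_tmul, AlgHom.id_apply, mulLeft_one_tmul_tmul]

/-- The compatibility with the coproduct on `B₊(x)`, deduced from the refined one on `x`. -/
lemma coaction_comul_bPlus (x : HCK k)
    (hx : map (AlgHom.id k (HCK k)) (map (AlgHom.id k (HCon k)) (HCK.comulHom k))
      (rootCoaction k x) = rootCoactionSq k (HCK.comulHom k x)) :
    map (AlgHom.id k (HCon k)) (HCK.comulHom k) (coaction k (bPlus k x)) =
      coactionSq k (HCK.comulHom k (bPlus k x)) := by
  have h1 : coactionSq k (bPlus k x ⊗ₜ[k] 1) = inclFst k (coaction k (bPlus k x)) := by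
    simp [coactionSq]
  rw [HCK.comulHom_bPlus, map_add, h1, coactionSq_lTensor_bPlus, ← hx, coaction_bPlus,
    map_comulHom_coactClose]

variable (k) in
-- Both sides obey the same recursion along `B₊`. The recursion also involves `Φ(B₊(x))`, whose
-- compatibility needs only the refined one at `x`, that is, the induction hypothesis.
lemma rootCoaction_comul :
    (map (AlgHom.id k (HCK k)) (map (AlgHom.id k (HCon k)) (HCK.comulHom k))).comp
      (rootCoaction k) = (rootCoactionSq k).comp (HCK.comulHom k) := by
  refine HCK.algHom_ext_bPlus fun x hx => ?_
  simp only [AlgHom.comp_apply] at hx ⊢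
  have h1 : rootCoactionSq k (bPlus k x ⊗ₜ[k] 1) =
      1 ⊗ₜ[k] inclFst k (coaction k (bPlus k x)) := by
    rw [rootCoactionSq, mulSnd_tmul, map_one, one_def, mulLeft_one_tmul_tmul, mul_one]
    rfl
  have h2 : coactionSq k (bPlus k x ⊗ₜ[k] 1) = inclFst k (coaction k (bPlus k x)) := by
    simp [coactionSq]
  rw [rootCoaction_bPlus, map_add, map_rTensor, hx, map_tmul, coaction_comul_bPlus x hx,
    HCK.comulHom_bPlus, map_add, map_add, h1, h2, rootCoactionSq_lTensor_bPlus,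
    TensorProduct.tmul_add, map_one]
  abel

/-- The Connes–Kreimer coproduct is a morphism of comodules. -/
lemma map_comulHom_coaction (x : HCK k) :
    map (AlgHom.id k (HCon k)) (HCK.comulHom k) (coaction k x) =
      coactionSq k (HCK.comulHom k x) := by
  have : (map (AlgHom.id k (HCon k)) (HCK.comulHom k)).comp (coaction k) =
      (coactionSq k).comp (HCK.comulHom k) :=
    HCK.algHom_ext_bPlus fun x _ =>
      coaction_comul_bPlus x (AlgHom.congr_fun (rootCoaction_comul k) x)
  exact AlgHom.congr_fun this x

/-! ### The counit of `𝓗` acts as the identity -/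

/-- The number of edges does not depend on the planar representative, and only `nil` has size zero.
-/
lemma RTree.mk_eq_bullet_iff {c : PForest} : RTree.mk c = RTree.bullet ↔ c = .nil := by
  refine ⟨fun h => ?_, fun h => h ▸ rfl⟩
  have : c.size = 0 := congrArg RTree.edges h
  cases c with
  | nil => rfl
  | cons c r => simp [PForest.size] at this

lemma HCon.counit_tree {t : RTree} (h : t ≠ RTree.bullet) :
    HCon.counit (HCon.tree t : HCon k) = 0 := by
  have : (HCon.tree t : HCon k) =
      MvPolynomial.X (R := k) (⟨t, h⟩ : {t : RTree // t ≠ RTree.bullet}) := dif_neg h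
  rw [this]
  exact MvPolynomial.aeval_X (R := k) _ _

/-- `B₊(c)` is the one-vertex tree, hence the unit of `𝓗`, exactly when `c` is the empty forest;
otherwise both counits vanish. -/
lemma counit_toHCon_bPlus (x : HCK k) :
    HCon.counit (toHCon (bPlus k x)) = HCK.counitHom k x := by
  have : (HCon.counit.comp toHCon).toLinearMap ∘ₗ bPlus k = (HCK.counitHom k).toLinearMap := by
    refine HCK.linearMap_ext fun c => ?_
    change HCon.counit (toHCon (bPlus k (HCK.forest c))) = HCK.counitHom k (HCK.forest c)
    rw [bPlus_forest, toHCon, HCK.lift_tree]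
    cases c with
    | nil =>
      have : (HCon.tree (RTree.mk .nil) : HCon k) = 1 := dif_pos rfl
      rw [this, HCK.forest, map_one, map_one]
    | cons c r =>
      have h : RTree.mk (.cons c r) ≠ RTree.bullet := fun h => by
        simpa using RTree.mk_eq_bullet_iff.1 h
      rw [HCon.counit_tree h, HCK.forest, map_mul, HCK.counitHom, HCK.lift_tree, zero_mul]
  exact LinearMap.congr_fun this x

variable (k) in
/-- The map `h ⊗ y ↦ ε(h) y`. -/
def counitSlice : HCon k ⊗[k] HCK k →ₐ[k] HCK k :=
  (Algebra.TensorProduct.lid k (HCK k)).toAlgHom.comp (map HCon.counit (AlgHom.id k _))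

@[simp] lemma counitSlice_tmul (h : HCon k) (y : HCK k) :
    counitSlice k (h ⊗ₜ[k] y) = HCon.counit h • y := by simp [counitSlice]

variable (k) in
/-- The map `x ⊗ h ⊗ y ↦ ε(x) ε(h) y`. -/
def rootCounitSlice : HCK k ⊗[k] (HCon k ⊗[k] HCK k) →ₐ[k] HCK k :=
  (Algebra.TensorProduct.lid k (HCK k)).toAlgHom.comp (map (HCK.counitHom k) (counitSlice k))

@[simp] lemma rootCounitSlice_tmul (x : HCK k) (w : HCon k ⊗[k] HCK k) :
    rootCounitSlice k (x ⊗ₜ[k] w) = HCK.counitHom k x • counitSlice k w := by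
  simp [rootCounitSlice]

lemma counitSlice_coactClose (w : HCK k ⊗[k] (HCon k ⊗[k] HCK k)) :
    counitSlice k (coactClose k w) = bPlus k (rootCounitSlice k w) := by
  have : (counitSlice k).toLinearMap ∘ₗ coactClose k =
      bPlus k ∘ₗ (rootCounitSlice k).toLinearMap := by
    refine tensor_ext_threefold fun x h y => ?_
    simp [coactClose_tmul, counit_toHCon_bPlus, mul_smul]
  exact LinearMap.congr_fun this w

variable (k) in
-- The counits select the empty set of marked edges. In the recursion for `Ψ(B₊(x))` the first term
-- dies because the counit kills the image of `B₊`.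
lemma rootCounitSlice_rootCoaction :
    (rootCounitSlice k).comp (rootCoaction k) = AlgHom.id k (HCK k) := by
  refine HCK.algHom_ext_bPlus fun x hx => ?_
  simp only [AlgHom.comp_apply, AlgHom.id_apply] at hx ⊢
  have h1 : ∀ w, rootCounitSlice k ((bPlus k).rTensor _ w) = 0 := by
    intro w
    induction w with
    | zero => simp
    | add p q hp hq => simp only [map_add, hp, hq, add_zero]
    | tmul y z => simp [HCK.counitHom_bPlus]
  rw [rootCoaction_bPlus, map_add, h1, rootCounitSlice_tmul, coaction_bPlus,
    counitSlice_coactClose, hx, map_one, one_smul, zero_add]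

lemma counitSlice_coaction (x : HCK k) : counitSlice k (coaction k x) = x := by
  have : (counitSlice k).comp (coaction k) = AlgHom.id k (HCK k) := by
    refine HCK.algHom_ext_bPlus fun x _ => ?_
    have := AlgHom.congr_fun (rootCounitSlice_rootCoaction k) x
    simp only [AlgHom.comp_apply, AlgHom.id_apply] at this ⊢
    rw [coaction_bPlus, counitSlice_coactClose, this]
  exact AlgHom.congr_fun this x

end compatibility

/-! ### Gradings -/

/-- The elements of degree `n` of a tensor product, for given notions of homogeneity on the
factors. -/
def tensorDegree {A B : Type*} [CommRing A] [CommRing B] [Algebra k A] [Algebra k B]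
    (P : A → ℕ → Prop) (Q : B → ℕ → Prop) (n : ℕ) : Submodule k (A ⊗[k] B) :=
  Submodule.span k {z | ∃ i j x y, i + j = n ∧ P x i ∧ Q y j ∧ z = x ⊗ₜ[k] y}

section tensorDegree

variable {A B : Type*} [CommRing A] [CommRing B] [Algebra k A] [Algebra k B]
  {P : A → ℕ → Prop} {Q : B → ℕ → Prop}

lemma tmul_mem_tensorDegree {i j n : ℕ} {x : A} {y : B} (h : i + j = n) (hx : P x i) (hy : Q y j) :
    x ⊗ₜ[k] y ∈ tensorDegree (k := k) P Q n :=
  Submodule.subset_span ⟨i, j, x, y, h, hx, hy, rfl⟩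

lemma mul_mem_tensorDegree
    (hP : ∀ x y i j, P x i → P y j → P (x * y) (i + j))
    (hQ : ∀ x y i j, Q x i → Q y j → Q (x * y) (i + j)) {m n : ℕ} {z w : A ⊗[k] B}
    (hz : z ∈ tensorDegree P Q m) (hw : w ∈ tensorDegree P Q n) :
    z * w ∈ tensorDegree P Q (m + n) := by
  induction hz using Submodule.span_induction with
  | zero => simp
  | add a b _ _ ha hb => rw [add_mul]; exact add_mem ha hb
  | smul r a _ ha => rw [smul_mul_assoc]; exact Submodule.smul_mem _ _ ha
  | mem z hz =>
    obtain ⟨i, j, x, y, rfl, hx, hy, rfl⟩ := hz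
    induction hw using Submodule.span_induction with
    | zero => simp
    | add a b _ _ ha hb => rw [mul_add]; exact add_mem ha hb
    | smul r a _ ha => rw [mul_smul_comm]; exact Submodule.smul_mem _ _ ha
    | mem w hw =>
      obtain ⟨i', j', x', y', rfl, hx', hy', rfl⟩ := hw
      rw [Algebra.TensorProduct.tmul_mul_tmul]
      exact tmul_mem_tensorDegree (by omega) (hP _ _ _ _ hx hx') (hQ _ _ _ _ hy hy')

/-- If `i + j ≥ M + N`, then `i ≥ M` or `j ≥ N`, so one of the two factors vanishes. -/
lemma map_eq_zero_of_mem_tensorDegree {a : A →ₗ[k] k} {b : B →ₗ[k] k} {M N n : ℕ}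
    (ha : ∀ i ≥ M, ∀ x, P x i → a x = 0) (hb : ∀ i ≥ N, ∀ x, Q x i → b x = 0)
    (hn : n ≥ M + N) {z : A ⊗[k] B} (hz : z ∈ tensorDegree P Q n) :
    LinearMap.mul' k k (TensorProduct.map a b z) = 0 := by
  induction hz using Submodule.span_induction with
  | zero => simp
  | add a b _ _ ha hb => rw [map_add, map_add, ha, hb, add_zero]
  | smul r a _ ha => rw [map_smul, map_smul, ha, smul_zero]
  | mem z hz =>
    obtain ⟨i, j, x, y, rfl, hx, hy, rfl⟩ := hz
    rw [TensorProduct.map_tmul, LinearMap.mul'_apply]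
    by_cases hi : i ≥ M
    · rw [ha i hi x hx, zero_mul]
    · rw [hb j (by omega) y hy, mul_zero]

end tensorDegree

/-! ### Degrees of trees and forests, and their preservation by `Φ` and `Δ` -/

lemma HCK.IsHomogeneous.mul {x y : HCK k} {i j : ℕ} (hx : HCK.IsHomogeneous x i)
    (hy : HCK.IsHomogeneous y j) : HCK.IsHomogeneous (x * y) (i + j) :=
  MvPolynomial.IsWeightedHomogeneous.mul (R := k) hx hy

lemma HCK.isHomogeneous_one : HCK.IsHomogeneous (1 : HCK k) 0 :=
  MvPolynomial.isWeightedHomogeneous_one (R := k) _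

lemma HCK.isHomogeneous_tree (c : PForest) :
    HCK.IsHomogeneous (HCK.tree (RTree.mk c) : HCK k) (c.size + 1) :=
  MvPolynomial.isWeightedHomogeneous_X (R := k) RTree.vertices (RTree.mk c)

lemma HCK.isHomogeneous_forest (c : PForest) :
    HCK.IsHomogeneous (HCK.forest c : HCK k) c.size := by
  induction c with
  | nil => exact HCK.isHomogeneous_one
  | cons c r _ ih => exact (HCK.isHomogeneous_tree c).mul ih

open Classical in
lemma PForest.exists_toFinsupp_eq (s : RTree →₀ ℕ) : ∃ c : PForest,
    Multiset.toFinsupp (c.toList.map RTree.mk : List RTree) = s := by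
  have h : ∀ l : List RTree, (PForest.ofList (l.map Quot.out)).toList.map RTree.mk = l := by
    intro l
    induction l with
    | nil => rfl
    | cons a l ih => exact congrArg₂ List.cons (RTree.mk_out a) ih
  refine ⟨.ofList ((Finsupp.toMultiset s).toList.map Quot.out), ?_⟩
  rw [h, Multiset.coe_toList, Finsupp.toMultiset_toFinsupp]

lemma HCK.IsHomogeneous.mem_span {x : HCK k} {n : ℕ} (hx : HCK.IsHomogeneous x n) :
    x ∈ Submodule.span k {z : HCK k | ∃ c : PForest, c.size = n ∧ z = HCK.forest c} := by
  classical
  have hx' : x = ∑ s ∈ MvPolynomial.support (R := k) x,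
      MvPolynomial.coeff (R := k) s x • (MvPolynomial.monomial s (1 : k) : HCK k) := by
    conv_lhs => rw [MvPolynomial.as_sum (R := k) x]
    refine Finset.sum_congr rfl fun s _ => ?_
    refine Eq.trans ?_ (MvPolynomial.smul_monomial (R := k) (S₁ := k) _).symm
    rw [smul_eq_mul, mul_one]
  rw [hx']
  refine Submodule.sum_mem _ fun s hs => Submodule.smul_mem _ _ ?_
  obtain ⟨c, rfl⟩ := PForest.exists_toFinsupp_eq s
  have hw := hx (MvPolynomial.mem_support_iff.1 hs)
  exact Submodule.subset_span ⟨c, (HCK.weight_forest c).symm.trans hw, (HCK.forest_eq c).symm⟩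

/-- A linear map sends the elements of degree `n` to a submodule if it does so for forests. -/
lemma HCK.IsHomogeneous.map_mem {M : Type*} [AddCommGroup M] [Module k M] (f : HCK k →ₗ[k] M)
    {S : Submodule k M} {n : ℕ} (H : ∀ c : PForest, c.size = n → f (HCK.forest c) ∈ S) {x : HCK k}
    (hx : HCK.IsHomogeneous x n) : f x ∈ S := by
  have : Submodule.span k {z : HCK k | ∃ c : PForest, c.size = n ∧ z = HCK.forest c} ≤
      S.comap f := by
    rw [Submodule.span_le]
    rintro _ ⟨c, hc, rfl⟩
    exact H c hc
  exact this hx.mem_span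

lemma HCon.IsHomogeneous.mul {x y : HCon k} {i j : ℕ} (hx : HCon.IsHomogeneous x i)
    (hy : HCon.IsHomogeneous y j) : HCon.IsHomogeneous (x * y) (i + j) :=
  MvPolynomial.IsWeightedHomogeneous.mul (R := k) hx hy

lemma HCon.isHomogeneous_one : HCon.IsHomogeneous (1 : HCon k) 0 :=
  MvPolynomial.isWeightedHomogeneous_one (R := k) _

lemma HCon.isHomogeneous_tree (c : PForest) :
    HCon.IsHomogeneous (HCon.tree (RTree.mk c) : HCon k) c.size := by
  by_cases h : RTree.mk c = RTree.bullet
  · have h1 : (HCon.tree (RTree.mk c) : HCon k) = 1 := dif_pos h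
    rw [h1, RTree.mk_eq_bullet_iff.1 h]
    exact HCon.isHomogeneous_one
  · have h1 : (HCon.tree (RTree.mk c) : HCon k) = MvPolynomial.X (R := k)
      (⟨RTree.mk c, h⟩ : {t : RTree // t ≠ RTree.bullet}) := dif_neg h
    rw [h1]
    exact MvPolynomial.isWeightedHomogeneous_X (R := k)
      (fun t : {t : RTree // t ≠ RTree.bullet} => t.1.edges) ⟨RTree.mk c, h⟩

/-- The number of edges of a forest. -/
def PForest.edgeCount : PForest → ℕ
  | nil => 0
  | cons c r => c.size + r.edgeCount

lemma PForest.edgeCount_append (c d : PForest) :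
    (c.append d).edgeCount = c.edgeCount + d.edgeCount := by
  induction c with
  | nil => simp [append, edgeCount]
  | cons c r _ ih => simp only [append, edgeCount, ih]; omega

lemma HCon.isHomogeneous_forest (c : PForest) :
    HCon.IsHomogeneous (HCon.forest c : HCon k) c.edgeCount := by
  induction c with
  | nil => exact HCon.isHomogeneous_one
  | cons c r _ ih => exact (HCon.isHomogeneous_tree c).mul ih

/-- Marked edges are the edges of the components; unmarked ones survive in the contracted tree. -/
lemma MForest.edgeCount_components_add_size_contract (m : MForest) :
    m.components.edgeCount + m.contract.size = m.erase.size := by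
  simp only [components, PForest.edgeCount]
  induction m with
  | nil => rfl
  | cons b c r ihc ihr =>
    cases b <;>
    · simp only [rootComponent, otherComponents, contract, erase, PForest.edgeCount, PForest.size,
        PForest.edgeCount_append, HCK.size_append]
      omega

/-- Each vertex other than the root lies above or under the cut. Admissibility is not needed:
`pruning` takes everything above the lowest marked edges, whatever is marked there. -/
lemma MForest.size_pruning_add_size_trunk (m : MForest) :
    m.pruning.size + m.trunk.size = m.erase.size := by
  induction m with
  | nil => rfl
  | cons b c r ihc ihr =>
    cases b <;>
    · simp only [pruning, trunk, erase, PForest.size, HCK.size_append]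
      omega

lemma list_sum_map_mem {α M : Type*} [AddCommGroup M] [Module k M] (S : Submodule k M) (l : List α)
    (f : α → M) (H : ∀ x ∈ l, f x ∈ S) : (l.map f).sum ∈ S := by
  refine list_sum_mem fun y hy => ?_
  obtain ⟨x, hx, rfl⟩ := List.mem_map.1 hy
  exact H x hx

lemma coactTree_mem_tensorDegree (c : PForest) : coactTree k c ∈
    tensorDegree HCon.IsHomogeneous HCK.IsHomogeneous (c.size + 1) := by
  refine list_sum_map_mem _ _ _ fun m hm => ?_
  refine tmul_mem_tensorDegree ?_ (HCon.isHomogeneous_forest _) (HCK.isHomogeneous_tree _)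
  -- The summand `1` is the root of `t/s`, which turns edges of the contracted tree into vertices.
  rw [← erase_of_mem_markings c m hm, ← m.edgeCount_components_add_size_contract, add_assoc]

/-- The coaction preserves degrees. -/
lemma coaction_mem_tensorDegree {x : HCK k} {n : ℕ} (hx : HCK.IsHomogeneous x n) :
    coaction k x ∈ tensorDegree HCon.IsHomogeneous HCK.IsHomogeneous n := by
  refine HCK.IsHomogeneous.map_mem (coaction k).toLinearMap ?_ hx
  clear hx
  rintro c rfl
  change coaction k (HCK.forest c) ∈ _
  induction c with
  | nil =>
    rw [HCK.forest, map_one, Algebra.TensorProduct.one_def]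
    exact tmul_mem_tensorDegree rfl HCon.isHomogeneous_one HCK.isHomogeneous_one
  | cons c r _ ih =>
    rw [HCK.forest, map_mul, coaction_tree]
    exact mul_mem_tensorDegree (fun _ _ _ _ => HCon.IsHomogeneous.mul)
      (fun _ _ _ _ => HCK.IsHomogeneous.mul) (coactTree_mem_tensorDegree c) ih

/-- The Connes–Kreimer coproduct preserves degrees. -/
lemma comulHom_mem_tensorDegree {x : HCK k} {n : ℕ} (hx : HCK.IsHomogeneous x n) :
    HCK.comulHom k x ∈ tensorDegree HCK.IsHomogeneous HCK.IsHomogeneous n := by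
  refine HCK.IsHomogeneous.map_mem (HCK.comulHom k).toLinearMap ?_ hx
  rintro c rfl
  change HCK.comulHom k (HCK.forest c) ∈ _
  rw [HCK.comulHom_forest]
  refine list_sum_map_mem _ _ _ fun m hm => ?_
  refine tmul_mem_tensorDegree ?_ (HCK.isHomogeneous_forest _) (HCK.isHomogeneous_forest _)
  rw [← erase_of_mem_markings c m (List.mem_of_mem_filter hm), m.size_pruning_add_size_trunk]

/-- The elements of degree zero of `𝓗` are the constants. -/
lemma HCon.IsHomogeneous.exists_eq_algebraMap {x : HCon k} (hx : HCon.IsHomogeneous x 0) :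
    ∃ r : k, x = algebraMap k (HCon k) r := by
  have h1 := MvPolynomial.weightedHomogeneousComponent_zero (R := k)
    (w := fun t : {t : RTree // t ≠ RTree.bullet} => t.1.edges) x fun t => by
      -- Every generator of `𝓗` has positive degree, since a tree without edges is the one-vertex
      -- tree.
      obtain ⟨t, ht⟩ := t
      obtain ⟨c, rfl⟩ := Quot.exists_rep t
      intro h
      refine ht (RTree.mk_eq_bullet_iff.2 ?_)
      have h : c.size = 0 := h
      cases c with
      | nil => rfl
      | cons c r => simp [PForest.size] at h
  exact ⟨MvPolynomial.coeff (R := k) 0 x,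
    (MvPolynomial.IsWeightedHomogeneous.weightedHomogeneousComponent_same (R := k) hx).symm.trans
      h1⟩

/-! ### The operators attached to characters are bijective -/

variable (k) in
/-- The elements of degree less than `n`. -/
def HCK.lowDegree (n : ℕ) : Submodule k (HCK k) :=
  Submodule.span k {x | ∃ i < n, HCK.IsHomogeneous x i}

lemma HCK.exists_mem_lowDegree (x : HCK k) : ∃ n, x ∈ HCK.lowDegree k n := by
  classical
  obtain ⟨N, hN⟩ : ∃ N, ∀ s ∈ MvPolynomial.support (R := k) x, HCK.weight s < N :=
    ⟨(MvPolynomial.support (R := k) x).sup HCK.weight + 1,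
      fun s hs => Nat.lt_succ_iff.2 (Finset.le_sup (f := HCK.weight) hs)⟩
  refine ⟨N, ?_⟩
  rw [MvPolynomial.as_sum (R := k) x]
  exact Submodule.sum_mem (HCK.lowDegree k N) fun s hs => Submodule.subset_span ⟨HCK.weight s,
    hN s hs, MvPolynomial.isWeightedHomogeneous_monomial (R := k) _ _ _ rfl⟩

/-- Since `x = (ε ⊗ Id)Φ(x)`, the difference is the slice of `Φ(x)` by `φ - ε`. On terms of
`𝓗`-degree zero, which are constants, `φ` and `ε` agree; on the others the remaining leg has degree
less than `n`. -/
lemma transposeL_sub_mem (φ : HCon k →ₐ[k] k) {x : HCK k} {n : ℕ} (hx : HCK.IsHomogeneous x n) :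
    transposeL φ.toLinearMap x - x ∈ HCK.lowDegree k n := by
  have key : ∀ w ∈ tensorDegree (k := k) HCon.IsHomogeneous HCK.IsHomogeneous n,
      TensorProduct.lid k (HCK k) (TensorProduct.map φ.toLinearMap LinearMap.id w) -
        counitSlice k w ∈ HCK.lowDegree k n := by
    intro w hw
    induction hw using Submodule.span_induction with
    | zero => simp
    | add a b _ _ ha hb => simp only [map_add, add_sub_add_comm]; exact add_mem ha hb
    | smul r a _ ha => simp only [map_smul, ← smul_sub]; exact Submodule.smul_mem _ _ ha
    | mem z hz =>
      obtain ⟨i, j, x, y, hij, hx, hy, rfl⟩ := hz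
      rw [TensorProduct.map_tmul, TensorProduct.lid_tmul, counitSlice_tmul, LinearMap.id_apply]
      rcases Nat.eq_zero_or_pos i with rfl | hi
      · obtain ⟨r, rfl⟩ := hx.exists_eq_algebraMap
        simp
      · have : y ∈ HCK.lowDegree k n := Submodule.subset_span ⟨j, by omega, hy⟩
        exact sub_mem (Submodule.smul_mem _ _ this) (Submodule.smul_mem _ _ this)
  have := key _ (coaction_mem_tensorDegree hx)
  rw [counitSlice_coaction] at this
  exact this

/-- On the kernel of `T`, the operator `T - 1` is `-1`, which is nilpotent only at `0`. For
surjectivity, a solution of `T y = (T - 1) x` gives `T (x - y) = x`, and `(T - 1) x` is killed by a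
smaller power. -/
lemma bijective_of_locally_nilpotent {M : Type*} [AddCommGroup M] [Module k M] (T : M →ₗ[k] M)
    (H : ∀ x, ∃ n, ((T - 1 : Module.End k M) ^ n) x = 0) : Function.Bijective T := by
  constructor
  · rw [injective_iff_map_eq_zero]
    intro x hx
    obtain ⟨n, hn⟩ := H x
    have : ∀ n : ℕ, ((T - 1 : Module.End k M) ^ n) x = (-1 : ℤ) ^ n • x := by
      intro n
      induction n with
      | zero => simp
      | succ n ih =>
        rw [pow_succ', Module.End.mul_apply, ih, map_zsmul, LinearMap.sub_apply, hx,
          Module.End.one_apply, zero_sub, pow_succ, mul_smul, neg_smul, one_smul]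
    rw [this] at hn
    rcases neg_one_pow_eq_or ℤ n with h | h <;> simpa [h] using hn
  · have : ∀ (n : ℕ) (x : M), ((T - 1 : Module.End k M) ^ n) x = 0 → ∃ y, T y = x := by
      intro n
      induction n with
      | zero => intro x hx; exact ⟨0, by simpa using hx.symm⟩
      | succ n ih =>
        intro x hx
        rw [pow_succ, Module.End.mul_apply] at hx
        obtain ⟨y, hy⟩ := ih _ hx
        exact ⟨x - y, by rw [map_sub, hy]; simp⟩
    intro x
    obtain ⟨n, hn⟩ := H x
    exact this n x hn

lemma transposeL_bijective (φ : HCon k →ₐ[k] k) :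
    Function.Bijective (transposeL φ.toLinearMap) := by
  refine bijective_of_locally_nilpotent _ fun x => ?_
  obtain ⟨n, hn⟩ := HCK.exists_mem_lowDegree x
  -- `T - 1` maps degrees less than `n + 1` to degrees less than `n`, so its `n`-th power kills all
  -- degrees less than `n`.
  refine ⟨n, ?_⟩
  induction n generalizing x with
  | zero =>
    have : HCK.lowDegree k 0 = ⊥ := by simp [HCK.lowDegree]
    rw [this, Submodule.mem_bot] at hn
    rw [hn, map_zero]
  | succ n ih =>
    rw [pow_succ, Module.End.mul_apply]
    refine ih _ ?_
    induction hn using Submodule.span_induction with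
    | zero => simp
    | add a b _ _ ha hb => rw [map_add]; exact add_mem ha hb
    | smul r a _ ha => rw [map_smul]; exact Submodule.smul_mem _ _ ha
    | mem z hz =>
      obtain ⟨i, hi, hz⟩ := hz
      refine Submodule.span_mono ?_ (transposeL_sub_mem φ hz)
      rintro _ ⟨j, hj, h⟩
      exact ⟨j, by omega, h⟩

/-! ### Operators attached to linear forms on `𝓗` -/

section slice

variable {W : Type*} [CommRing W] [Algebra k W]

/-- The map `h ⊗ y ↦ a(h) y`. -/
def slice (W : Type*) [CommRing W] [Algebra k W] (a : HCon k →ₗ[k] k) : HCon k ⊗[k] W →ₗ[k] W :=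
  (TensorProduct.lid k W).toLinearMap ∘ₗ TensorProduct.map a LinearMap.id

@[simp] lemma slice_tmul (a : HCon k →ₗ[k] k) (h : HCon k) (y : W) :
    slice W a (h ⊗ₜ[k] y) = a h • y := by simp [slice]

lemma slice_mul_of_algHom (φ : HCon k →ₐ[k] k) (p q : HCon k ⊗[k] W) :
    slice W φ.toLinearMap (p * q) = slice W φ.toLinearMap p * slice W φ.toLinearMap q := by
  induction p with
  | zero => simp
  | add p p' hp hp' => simp only [add_mul, map_add, hp, hp']
  | tmul h y =>
    induction q with
    | zero => simp
    | add q q' hq hq' => simp only [mul_add, map_add, hq, hq']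
    | tmul h' y' => simp [smul_smul, mul_comm]

lemma slice_mul_of_isInfinitesimalCharacter {a : HCon k →ₗ[k] k} (ha : IsInfinitesimalCharacter a)
    (p q : HCon k ⊗[k] W) :
    slice W a (p * q) = slice W a p * slice W HCon.counit.toLinearMap q +
      slice W HCon.counit.toLinearMap p * slice W a q := by
  induction p with
  | zero => simp
  | add p p' hp hp' => simp only [add_mul, map_add, hp, hp']; ring
  | tmul h y =>
    induction q with
    | zero => simp
    | add q q' hq hq' => simp only [mul_add, map_add, hq, hq']; ring
    | tmul h' y' => simp [ha h h', add_smul, smul_smul, mul_comm]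

/-- The two maps act on different legs. With `f = Δ`, this turns the comodule compatibility into a
formula for `Δ ∘ ᵗL_a`. -/
lemma slice_map_id {V : Type*} [CommRing V] [Algebra k V] (a : HCon k →ₗ[k] k) (f : V →ₐ[k] W)
    (p : HCon k ⊗[k] V) :
    slice W a (Algebra.TensorProduct.map (AlgHom.id k _) f p) = f (slice V a p) := by
  induction p with
  | zero => simp
  | add p p' hp hp' => simp only [map_add, hp, hp']
  | tmul h y => simp

end slice

lemma transposeL_apply (a : HCon k →ₗ[k] k) (x : HCK k) :
    transposeL a x = slice (HCK k) a (coaction k x) := rfl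

lemma transposeL_counit (x : HCK k) : transposeL HCon.counit.toLinearMap x = x :=
  counitSlice_coaction x

lemma comulHom_transposeL (a : HCon k →ₗ[k] k) (x : HCK k) :
    HCK.comulHom k (transposeL a x) = slice _ a (coactionSq k (HCK.comulHom k x)) := by
  rw [transposeL_apply, ← slice_map_id, map_comulHom_coaction]

lemma slice_inclFst (a : HCon k →ₗ[k] k) (x : HCK k) :
    slice _ a (inclFst k (coaction k x)) = transposeL a x ⊗ₜ[k] 1 :=
  slice_map_id _ _ _

lemma slice_inclSnd (a : HCon k →ₗ[k] k) (x : HCK k) :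
    slice _ a (inclSnd k (coaction k x)) = 1 ⊗ₜ[k] transposeL a x :=
  slice_map_id _ _ _

/-- The operator attached to an infinitesimal character is a biderivation. -/
lemma isBiderivation_transposeL {a : HCon k →ₗ[k] k} (ha : IsInfinitesimalCharacter a) :
    IsBiderivation (transposeL a) where
  leibniz x y := by
    rw [transposeL_apply, map_mul, slice_mul_of_isInfinitesimalCharacter ha]
    simp only [← transposeL_apply, transposeL_counit]
  coleibniz := by
    refine LinearMap.ext fun x => ?_
    change HCK.comulHom k (transposeL a x) = (TensorProduct.map (transposeL a) LinearMap.id +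
      TensorProduct.map LinearMap.id (transposeL a) : HCK k ⊗[k] HCK k →ₗ[k] _) (HCK.comulHom k x)
    rw [comulHom_transposeL]
    induction HCK.comulHom k x with
    | zero => simp
    | add p q hp hq => simp only [map_add, hp, hq]
    | tmul y z =>
      -- On a term `y ⊗ z` of the coproduct the Leibniz rule gives `(ᵗL_a y ⊗ 1)(1 ⊗ z) + (y ⊗ 1)(1
      -- ⊗ ᵗL_a z)`, because `ε` acts as the identity.
      rw [coactionSq, Algebra.TensorProduct.productMap_apply_tmul, AlgHom.comp_apply,
        AlgHom.comp_apply, slice_mul_of_isInfinitesimalCharacter ha, slice_inclFst, slice_inclFst,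
        slice_inclSnd, slice_inclSnd, transposeL_counit, transposeL_counit]
      simp

/-- The operator attached to a character, as an algebra morphism. -/
def transposeHom (φ : HCon k →ₐ[k] k) : HCK k →ₐ[k] HCK k :=
  AlgHom.ofLinearMap (transposeL φ.toLinearMap)
    (by simp [transposeL_apply, Algebra.TensorProduct.one_def])
    fun x y => by simp only [transposeL_apply, map_mul, slice_mul_of_algHom]

lemma transposeHom_apply (φ : HCon k →ₐ[k] k) (x : HCK k) :
    transposeHom φ x = transposeL φ.toLinearMap x := rfl

lemma comulHom_transposeHom (φ : HCon k →ₐ[k] k) (x : HCK k) :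
    HCK.comulHom k (transposeHom φ x) =
      Algebra.TensorProduct.map (transposeHom φ) (transposeHom φ) (HCK.comulHom k x) := by
  rw [transposeHom_apply, comulHom_transposeL]
  induction HCK.comulHom k x with
  | zero => simp
  | add p q hp hq => simp only [map_add, hp, hq]
  | tmul y z =>
    rw [coactionSq, Algebra.TensorProduct.productMap_apply_tmul, AlgHom.comp_apply,
      AlgHom.comp_apply, slice_mul_of_algHom, slice_inclFst, slice_inclSnd]
    simp [transposeHom_apply]

/-- Contracting edges of a tree leaves a non-empty tree, on which the counit vanishes. -/
lemma counitHom_transposeHom (φ : HCon k →ₐ[k] k) (x : HCK k) :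
    HCK.counitHom k (transposeHom φ x) = HCK.counitHom k x := by
  have : (HCK.counitHom k).comp (transposeHom φ) = HCK.counitHom k := by
    refine HCK.algHom_ext fun t => ?_
    obtain ⟨c, rfl⟩ := Quot.exists_rep t
    change HCK.counitHom k (slice _ _ (coaction k (HCK.tree (RTree.mk c)))) =
      HCK.counitHom k (HCK.tree (RTree.mk c))
    rw [coaction_tree, coactTree, map_list_sum, map_list_sum, List.map_map, List.map_map]
    have h (t : RTree) : HCK.counitHom k (HCK.tree t) = 0 := HCK.lift_tree _ _
    simp [Function.comp_def, h]
  exact AlgHom.congr_fun this x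

/-- The operator attached to a character, as a bialgebra morphism. -/
def transposeBialgHom (φ : HCon k →ₐ[k] k) : HCK k →ₐc[k] HCK k :=
  BialgHom.ofAlgHom (transposeHom φ) (AlgHom.ext fun x => counitHom_transposeHom φ x)
    (AlgHom.ext fun x => (comulHom_transposeHom φ x).symm)

/-- The operator attached to a character, as an automorphism of bialgebras. -/
def transposeEquiv (φ : HCon k →ₐ[k] k) : HCK k ≃ₐc[k] HCK k :=
  BialgEquiv.ofBijective (transposeBialgHom φ) (transposeL_bijective φ)

lemma transposeEquiv_apply (φ : HCon k →ₐ[k] k) (x : HCK k) :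
    transposeEquiv φ x = transposeL φ.toLinearMap x := rfl

open WithConv in
/-- Bialgebra morphisms between Hopf algebras commute with the antipodes. -/
lemma bialgHom_antipode {A B : Type*} [CommRing A] [CommRing B] [HopfAlgebra k A]
    [HopfAlgebra k B] (f : A →ₐc[k] B) (x : A) :
    f (HopfAlgebra.antipode k x) = HopfAlgebra.antipode k (f x) := by
  set F : A →ₗ[k] B := (f : A →ₐ[k] B).toLinearMap
  -- For convolution, `f ∘ S` is a left inverse of `f` and `S ∘ f` a right inverse, so they
  -- coincide.
  have h1 : toConv (F ∘ₗ HopfAlgebra.antipode k) * toConv F = 1 := by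
    have := LinearMap.algHom_comp_convMul_distrib (f : A →ₐ[k] B)
      (toConv (HopfAlgebra.antipode k (A := A))) (toConv LinearMap.id)
    rw [LinearMap.antipode_mul_id] at this
    refine WithConv.ofConv_injective (this.symm.trans ?_)
    exact LinearMap.ext fun y => (f : A →ₐ[k] B).commutes _
  have h2 : toConv F * toConv (HopfAlgebra.antipode k ∘ₗ F) = 1 := by
    have := LinearMap.convMul_comp_coalgHom_distrib
      (toConv LinearMap.id) (toConv (HopfAlgebra.antipode k (A := B))) (f : A →ₗc[k] B)
    rw [LinearMap.id_mul_antipode] at this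
    refine WithConv.ofConv_injective (this.symm.trans ?_)
    ext y
    simp [LinearMap.convOne_def]
  exact LinearMap.congr_fun (congrArg WithConv.ofConv (left_inv_eq_right_inv h1 h2)) x

lemma antipode_transposeL (φ : HCon k →ₐ[k] k) (x : HCK k) :
    transposeL φ.toLinearMap (HopfAlgebra.antipode k x) =
      HopfAlgebra.antipode k (transposeL φ.toLinearMap x) :=
  bialgHom_antipode (transposeBialgHom φ) x

/-! ### Operators on the complete dual -/

lemma leftMul_eq_dualMap (a : HCon k →ₗ[k] k) : leftMul a = (transposeL a).dualMap := by
  refine LinearMap.ext fun b => LinearMap.ext fun x => ?_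
  change LinearMap.mul' k k (TensorProduct.map a b (coaction k x)) =
    b (slice _ a (coaction k x))
  induction coaction k x with
  | zero => simp
  | add p q hp hq => simp only [map_add, hp, hq]
  | tmul y z => simp

lemma leftMul_apply (a : HCon k →ₗ[k] k) (b : Module.Dual k (HCK k)) (x : HCK k) :
    leftMul a b x = b (transposeL a x) := by rw [leftMul_eq_dualMap]; rfl

/-! ### Transposition of biderivations and automorphisms -/

section dual

variable {C : Type*} [CommRing C] [Bialgebra k C]

lemma conv_eq (b c : Module.Dual k C) (x : C) :
    conv b c x = LinearMap.mul' k k (TensorProduct.map b c (Coalgebra.comul x)) := rfl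

/-- The transpose of a biderivation is a biderivation of the complete dual. -/
lemma IsBiderivation.dualMap {T : C →ₗ[k] C} (hT : IsBiderivation T) :
    IsDualBiderivation T T.dualMap where
  transpose := rfl
  -- Transposition exchanges the two axioms: the coderivation property of `T` gives the Leibniz rule
  -- for convolution, and the Leibniz rule of `T` gives the coderivation property.
  leibniz b c := by
    refine LinearMap.ext fun x => ?_
    have h := LinearMap.congr_fun hT.coleibniz x
    simp only [LinearMap.comp_apply] at h
    change conv b c (T x) = conv (b ∘ₗ T) c x + conv b (c ∘ₗ T) x
    rw [conv_eq, conv_eq, conv_eq, h, LinearMap.add_apply, map_add, map_add,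
      ← LinearMap.comp_apply (TensorProduct.map b c),
      ← LinearMap.comp_apply (TensorProduct.map b c), ← TensorProduct.map_comp,
      ← TensorProduct.map_comp, LinearMap.comp_id, LinearMap.comp_id]
  coleibniz b := by
    refine TensorProduct.ext' fun x y => ?_
    simp [dualComul, dualTensor, hT.leibniz]

end dual

lemma isDualAutomorphism_leftMul {k : Type u} [Field k] (φ : HCon k →ₐ[k] k) :
    IsDualAutomorphism (transposeL φ.toLinearMap) (leftMul φ.toLinearMap) where
  transpose := leftMul_eq_dualMap _
  bijective := by
    rw [leftMul_eq_dualMap]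
    exact LinearMap.dualMap_bijective_iff.2 (transposeL_bijective φ)
  map_conv b c := by
    refine LinearMap.ext fun x => ?_
    have h : HCK.comulHom k (transposeL φ.toLinearMap x) =
        TensorProduct.map (transposeL φ.toLinearMap) (transposeL φ.toLinearMap)
          (HCK.comulHom k x) := comulHom_transposeHom φ x
    rw [leftMul_apply, conv_eq, conv_eq]
    change LinearMap.mul' k k (TensorProduct.map b c (HCK.comulHom k (transposeL φ.toLinearMap x)))
      = LinearMap.mul' k k (TensorProduct.map _ _ (HCK.comulHom k x))
    rw [h, ← LinearMap.comp_apply (TensorProduct.map b c), ← TensorProduct.map_comp,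
      leftMul_eq_dualMap]
    rfl
  map_unit := LinearMap.ext fun x => (leftMul_apply _ _ _).trans (counitHom_transposeHom φ x)
  map_comul b := by
    refine TensorProduct.ext' fun x y => ?_
    simp only [dualComul, dualTensor, LinearMap.dualMap_apply, LinearMap.mul'_apply,
      leftMul_apply, TensorProduct.map_tmul, ← transposeHom_apply, map_mul]
  map_counit b := by rw [leftMul_apply, ← transposeHom_apply, map_one]
  map_antipode b := by
    refine LinearMap.ext fun x => ?_
    rw [leftMul_apply, LinearMap.comp_apply, LinearMap.comp_apply, leftMul_apply,
      antipode_transposeL]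

/-! ### The graded dual -/

/-- `Φ` preserves the total degree, so the bounds for `a` and `b` add up. -/
lemma leftMul_mem_gradedDual {a : HCon k →ₗ[k] k} (ha : HCon.MemGradedDual a)
    {b : Module.Dual k (HCK k)} (hb : b ∈ HCK.gradedDual k) : leftMul a b ∈ HCK.gradedDual k := by
  obtain ⟨M, hM⟩ := ha
  obtain ⟨N, hN⟩ := hb
  exact ⟨M + N, fun n hn x hx =>
    map_eq_zero_of_mem_tensorDegree hM hN hn (coaction_mem_tensorDegree hx)⟩

lemma conv_mem_gradedDual {b c : Module.Dual k (HCK k)} (hb : b ∈ HCK.gradedDual k)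
    (hc : c ∈ HCK.gradedDual k) : conv b c ∈ HCK.gradedDual k := by
  obtain ⟨M, hM⟩ := hb
  obtain ⟨N, hN⟩ := hc
  exact ⟨M + N, fun n hn x hx =>
    map_eq_zero_of_mem_tensorDegree hM hN hn (comulHom_mem_tensorDegree hx)⟩

/-! ### Finiteness in each degree and the coproduct of the graded dual -/

lemma PForest.finite_size_lt (n : ℕ) : {c : PForest | c.size < n}.Finite := by
  induction n with
  | zero => simp
  | succ n ih =>
    refine ((Set.finite_singleton PForest.nil).union (ih.image2 PForest.cons ih)).subset ?_
    intro c hc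
    cases c with
    | nil => exact Or.inl rfl
    | cons c r =>
      simp only [Set.mem_ofPred_eq, PForest.size] at hc
      exact Or.inr ⟨c, by simp only [Set.mem_ofPred_eq]; omega, r,
        by simp only [Set.mem_ofPred_eq]; omega, rfl⟩

lemma HCK.finite_weight_lt (n : ℕ) : {s : RTree →₀ ℕ | HCK.weight s < n}.Finite := by
  classical
  refine ((PForest.finite_size_lt n).image fun c =>
    Multiset.toFinsupp (c.toList.map RTree.mk : List RTree)).subset fun s hs => ?_
  obtain ⟨c, rfl⟩ := PForest.exists_toFinsupp_eq s
  exact ⟨c, (HCK.weight_forest c).symm.trans_lt hs, rfl⟩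

variable (k) in
/-- The linear form dual to a monomial. -/
def HCK.coord (s : RTree →₀ ℕ) : Module.Dual k (HCK k) :=
  (MvPolynomial.basisMonomials RTree k).coord s

open Classical in
lemma HCK.coord_monomial (s t : RTree →₀ ℕ) :
    HCK.coord k s (MvPolynomial.monomial t (1 : k) : MvPolynomial RTree k) =
      if t = s then 1 else 0 := by
  have := (MvPolynomial.basisMonomials RTree k).repr_self_apply t s
  rw [MvPolynomial.coe_basisMonomials] at this
  exact this

lemma HCK.coord_mem_gradedDual (s : RTree →₀ ℕ) : HCK.coord k s ∈ HCK.gradedDual k := by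
  refine ⟨HCK.weight s + 1, fun n hn x hx => ?_⟩
  exact MvPolynomial.IsWeightedHomogeneous.coeff_eq_zero (R := k) hx s
    (by change HCK.weight s ≠ n; omega)

/-- The coproduct of the graded dual takes its values in the tensor square of the graded dual. -/
lemma exists_gradedDualPairing_eq {b : Module.Dual k (HCK k)} (hb : b ∈ HCK.gradedDual k) :
    ∃ z, gradedDualPairing k z = dualComul b := by
  classical
  obtain ⟨N, hN⟩ := hb
  let mon (s : RTree →₀ ℕ) : HCK k := (MvPolynomial.monomial s (1 : k) : MvPolynomial RTree k)
  have hmon (s) : HCK.IsHomogeneous (mon s) (HCK.weight s) :=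
    MvPolynomial.isWeightedHomogeneous_monomial (R := k) _ _ _ rfl
  let S := (HCK.finite_weight_lt N).toFinset
  -- This is the expansion of `dualComul b` in the dual basis. It is finite: if one factor of `mon s
  -- * mon t` has weight at least `N`, so does the product, and `b` kills it.
  refine ⟨∑ s ∈ S, ∑ t ∈ S, b (mon s * mon t) •
    ((⟨HCK.coord k s, HCK.coord_mem_gradedDual s⟩ : HCK.gradedDual k) ⊗ₜ[k]
      (⟨HCK.coord k t, HCK.coord_mem_gradedDual t⟩ : HCK.gradedDual k)), ?_⟩
  refine ((MvPolynomial.basisMonomials RTree k).tensorProduct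
    (MvPolynomial.basisMonomials RTree k)).ext (M₁ := k) fun p => ?_
  obtain ⟨s, t⟩ := p
  rw [Module.Basis.tensorProduct_apply, MvPolynomial.coe_basisMonomials]
  change gradedDualPairing k _ (mon s ⊗ₜ[k] mon t) = b (mon s * mon t)
  have hc (s' t' : RTree →₀ ℕ) : gradedDualPairing k
      ((⟨HCK.coord k s', HCK.coord_mem_gradedDual s'⟩ : HCK.gradedDual k) ⊗ₜ[k]
      (⟨HCK.coord k t', HCK.coord_mem_gradedDual t'⟩ : HCK.gradedDual k)) (mon s ⊗ₜ[k] mon t) =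
      (if s = s' then 1 else 0) * (if t = t' then 1 else 0) := by
    rw [← HCK.coord_monomial (k := k), ← HCK.coord_monomial (k := k)]
    rfl
  simp only [map_sum, map_smul, LinearMap.sum_apply, LinearMap.smul_apply, hc, smul_eq_mul]
  have hS (s) : s ∈ S ↔ HCK.weight s < N := by simp [S]
  have hst : HCK.IsHomogeneous (mon s * mon t) (HCK.weight s + HCK.weight t) :=
    (hmon s).mul (hmon t)
  by_cases hs : s ∈ S
  · by_cases ht : t ∈ S
    · rw [Finset.sum_eq_single s, Finset.sum_eq_single t] <;> simp +contextual [hs, ht, eq_comm]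
    · rw [hN _ (by rw [hS] at ht; omega) _ hst]
      refine Finset.sum_eq_zero fun s' _ => Finset.sum_eq_zero fun t' ht' => ?_
      rw [if_neg (fun h : t = t' => ht (h ▸ ht')), mul_zero, mul_zero]
  · rw [hN _ (by rw [hS] at hs; omega) _ hst]
    refine Finset.sum_eq_zero fun s' hs' => Finset.sum_eq_zero fun t' _ => ?_
    rw [if_neg (fun h : s = s' => hs (h ▸ hs')), zero_mul, mul_zero]

lemma isGradedDualBiderivation_leftMul {a : HCon k →ₗ[k] k} (ha : IsInfinitesimalCharacter a)
    (ha' : HCon.MemGradedDual a) : IsGradedDualBiderivation (leftMul a) := by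
  have hD := (isBiderivation_transposeL ha).dualMap
  rw [← leftMul_eq_dualMap] at hD
  refine ⟨fun b hb => leftMul_mem_gradedDual ha' hb,
    fun b hb c hc => ⟨conv_mem_gradedDual hb hc, hD.leibniz b c⟩,
    fun b hb => ⟨exists_gradedDualPairing_eq hb, fun z hz => ?_⟩⟩
  rw [hD.coleibniz, ← hz]
  -- What remains is that the pairing intertwines `L ⊗ Id` and `Id ⊗ L` with the transposes of `T ⊗
  -- Id` and `Id ⊗ T`. This holds for every `z`, so it can be checked on pure tensors, and no
  -- injectivity of the pairing is needed.
  clear hz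
  induction z with
  | zero => simp
  | add p q hp hq =>
    simp only [map_add] at hp hq ⊢
    rw [add_add_add_comm, hp, hq]
    abel
  | tmul b c =>
    refine TensorProduct.ext' fun x y => ?_
    simp [gradedDualPairing, dualTensor, leftMul_apply]

end

end ForestHopf

theorem mainTheorem2 (k : Type*) [Field k] [CharZero k] :
    (∀ a : HCon k →ₗ[k] k, IsInfinitesimalCharacter a →
      IsBiderivation (transposeL a) ∧
      IsDualBiderivation (transposeL a) (leftMul a) ∧
      (HCon.MemGradedDual a → IsGradedDualBiderivation (leftMul a))) ∧
    (∀ φ : HCon k →ₐ[k] k,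
      (∃ e : HCK k ≃ₐc[k] HCK k, (∀ x, e x = transposeL φ.toLinearMap x) ∧
        ∀ x, e (HopfAlgebra.antipode k x) = HopfAlgebra.antipode k (e x)) ∧
      IsDualAutomorphism (transposeL φ.toLinearMap) (leftMul φ.toLinearMap)) := by
  refine ⟨fun a ha => ⟨isBiderivation_transposeL ha, ?_, isGradedDualBiderivation_leftMul ha⟩,
    fun φ => ⟨⟨transposeEquiv φ, transposeEquiv_apply φ, antipode_transposeL φ⟩,
      isDualAutomorphism_leftMul φ⟩⟩
  rw [leftMul_eq_dualMap]
  exact (isBiderivation_transposeL ha).dualMap
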